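/- Let $\hbar>0$. Let $\mathcal H_S$ be a finite-dimensional Hilbert space and $A$ a non-degenerate observable on it, with orthonormal eigenbasis $(\varphi_k)_k$ and distinct real eigenvalues $a_k$ (at least two), and let $a_0=\min\{a_k-a_l : a_k>a_l\}$. The probe has Hilbert space $\mathcal H_{Pr}=L^2(\mathbb R)$, with position $Q$ (multiplication by $q$) and momentum $P=-i\hbar\,\partial_q$. The pointer has Hilbert space $\mathcal H_{Po}=L^2(\mathbb R,\mu)$, where $\mu$ is a locally finite Borel measure (e.g. Lebesgue measure), and its observable $B$ is multiplication by $b$. Let $\psi_0\in\mathcal H_S$, $\Psi\in\mathcal H_{Pr}$, $\Phi_0\in\mathcal H_{Po}$ be unit vectors, let $\lambda>0$, and let $\alpha$ be a real coupling constant; put $\beta=2\lambda/\alpha$. An entire function $f$ is called of exponential type $\tau$ if $|f(z)|<e^{\tau|z|}$ for all sufficiently large $|z|$. Assume that $\Psi$ is momentum limited: for some $\kappa_0>0$ and some $\tilde\psi\in L^2([-\kappa_0,\kappa_0])$, $$\Psi(x)=\int_{-\kappa_0}^{\kappa_0}e^{ixk}\tilde\psi(k)\,dk\qquad\text{for almost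 every }x .$$ Assume moreover that $$\alpha>\alpha_D=\frac{2\hbar\kappa_0}{a_0}.$$ Then the following hold. 1. $\Psi$ has an entire extension $\Psi(z)$ of exponential type $\kappa_0$, and for all $b,b'\in\mathbb R$ the function $z\mapsto\Psi(z-2\lambda b/\alpha)\,\overline{\Psi(\bar z-2\lambda b'/\alpha)}$ is entire and of exponential type $2\kappa_0$. 2. For all $k\neq l$ and all $b,b'\in\mathbb R$ the coherence kernel $$I_{kl}(b,b')=\int_{-\infty}^{\infty}e^{\frac i\hbar\alpha q(a_k-a_l)}\,\Psi(q-2\lambda b/\alpha)\,\overline{\Psi(q-2\lambda b'/\alpha)}\,dq$$ (an absolutely convergent integral) is equal to $0$. 3. There is exactly one strongly continuous one-parameter unitary group $e^{-itH_M/\hbar}$ on $\mathcal H_S\otimes\mathcal H_{Pr}\otimes\mathcal H_{Po}\cong L^2(\mathbb R^2,dq\times\mu;\mathcal H_S)$ whose generator extends $-\frac i\hbar H_M$, where $$H_M=\alpha\,A\otimes Q\otimes\mathbb I+\beta\,\mathbb I\otimes P\otimes B$$ on the vectors $f(q,b)\,v$ with $f\in C_c^\infty(\mathbb R^2)$ and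 $v\in\mathcal H_S$. With $U=e^{-iH_M/\hbar}$ and $\Psi_f=U(\psi_0\otimes\Psi\otimes\Phi_0)$, the reduced density matrix of system and pointer is exactly $$\operatorname{Tr}_{Pr}|\Psi_f\rangle\langle\Psi_f|=\sum_k|\langle\varphi_k|\psi_0\rangle|^2\,|\varphi_k\rangle\langle\varphi_k|\otimes\rho_k ,$$ $$\rho_k=\int_{-\infty}^{\infty}|\langle p|\Psi\rangle|^2\;e^{\frac i\hbar(\frac{\alpha a_k}{2}-p)\beta B}\,|\Phi_0\rangle\langle\Phi_0|\,e^{-\frac i\hbar(\frac{\alpha a_k}{2}-p)\beta B}\,dp ,$$ where $\langle p|\Psi\rangle=(2\pi\hbar)^{-1/2}\int e^{-ipq/\hbar}\Psi(q)\,dq$ is the momentum wave function (the unitary Fourier transform on $L^2(\mathbb R)$). -/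

import Mathlib

open MeasureTheory

open scoped ContDiff ComplexConjugate FourierTransform

noncomputable section

namespace ProbeMeasurement

/-! The probe has position `q` and Hilbert space `L²(ℝ, dq)`.  The pointer is described in the
spectral representation of its observable `B`, which has simple spectrum: the pointer space is
`L²(ℝ, μ)` and `B` is multiplication by `b` (Lebesgue measure `μ` is the case of kets `|b⟩` with
`∫ |b⟩⟨b| db = 1`).  The system space is `H`.  The tensor products `H ⊗ L²(dq) ⊗ L²(μ)` and
`H ⊗ L²(μ)` are realized as spaces of `H`-valued square integrable functions. -/

/-- The probe space `L²(ℝ)`. -/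
abbrev Probe : Type := Lp ℂ 2 (volume : Measure ℝ)

/-- The pointer space `L²(ℝ, μ)`. -/
abbrev Pointer (μ : Measure ℝ) : Type := Lp ℂ 2 μ

/-- System and pointer: `H ⊗ L²(μ) = L²(μ; H)`. -/
abbrev SysPointer (H : Type*) [NormedAddCommGroup H] (μ : Measure ℝ) : Type _ := Lp H 2 μ

/-- System, probe and pointer: `H ⊗ L²(dq) ⊗ L²(μ) = L²(dq × μ; H)`. -/
abbrev Total (H : Type*) [NormedAddCommGroup H] (μ : Measure ℝ) : Type _ :=
  Lp H 2 ((volume : Measure ℝ).prod μ)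

section Tensors

variable {H : Type*} [NormedAddCommGroup H] [InnerProductSpace ℂ H]
variable {μ : Measure ℝ}

theorem memLp_tensor [SFinite μ] (e : Probe) (u : SysPointer H μ) :
    MemLp (fun x : ℝ × ℝ => e x.1 • u x.2) 2 ((volume : Measure ℝ).prod μ) := by
  have he := Lp.memLp e
  have hu := Lp.memLp u
  have hm : AEStronglyMeasurable (fun x : ℝ × ℝ => e x.1 • u x.2)
      ((volume : Measure ℝ).prod μ) := he.1.comp_fst.smul hu.1.comp_snd
  rw [memLp_two_iff_integrable_sq_norm hm]
  have h1 := (memLp_two_iff_integrable_sq_norm he.1).1 he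
  have h2 := (memLp_two_iff_integrable_sq_norm hu.1).1 hu
  refine (h1.mul_prod h2).congr (Filter.Eventually.of_forall fun x => ?_)
  simp [norm_smul, mul_pow]

/-- `e ⊗ u`, for `e` in the probe space and `u` in the space of system and pointer. -/
def tensor [SFinite μ] (e : Probe) (u : SysPointer H μ) : Total H μ :=
  (memLp_tensor e u).toLp _

/-- The map `g ↦ v ⊗ g` from the pointer space to that of system and pointer. -/
def embed (μ : Measure ℝ) (v : H) : Pointer μ →L[ℂ] SysPointer H μ :=
  (ContinuousLinearMap.toSpanSingleton ℂ v).compLpL 2 μ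

/-- Its adjoint, `u ↦ ⟨v| u`, that is `b ↦ ⟨v, u b⟩`. -/
def contract (μ : Measure ℝ) (v : H) : SysPointer H μ →L[ℂ] Pointer μ :=
  (innerSL ℂ v).compLpL 2 μ

/-- The operator `|v⟩⟨v| ⊗ R` on system and pointer. -/
def projTensor (v : H) (R : Pointer μ →L[ℂ] Pointer μ) :
    SysPointer H μ →L[ℂ] SysPointer H μ :=
  (embed μ v).comp (R.comp (contract μ v))

/-- `ρ` is the partial trace of `T` over the probe. -/
def IsProbeTrace [SFinite μ] (T : Total H μ →L[ℂ] Total H μ)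
    (ρ : SysPointer H μ →L[ℂ] SysPointer H μ) : Prop :=
  ∀ (κ : Type) (e : HilbertBasis κ ℂ Probe) (u v : SysPointer H μ),
    HasSum (fun n => inner ℂ (tensor (e n) u) (T (tensor (e n) v))) (inner ℂ u (ρ v))

end Tensors

section Dynamics

variable {H : Type*} [NormedAddCommGroup H] [InnerProductSpace ℂ H]
variable {μ : Measure ℝ}

/-- The measurement Hamiltonian `α A ⊗ Q ⊗ 1 + β 1 ⊗ P ⊗ B`, with `Q` multiplication by `q`,
`P = -iħ ∂/∂q` and `B` multiplication by `b`, as the relation `H_M Ψ = X` on the vectors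
`Ψ = f(q, b) v` with `f` smooth and compactly supported. -/
def MeasHamiltonian (ħ α β : ℝ) (A : H →ₗ[ℂ] H) (Ψ X : Total H μ) : Prop :=
  ∃ (f : ℝ × ℝ → ℂ) (v : H), ContDiff ℝ ∞ f ∧ HasCompactSupport f ∧
    (Ψ =ᵐ[(volume : Measure ℝ).prod μ] fun x => f x • v) ∧
    (X =ᵐ[(volume : Measure ℝ).prod μ] fun x =>
      ((α : ℂ) * ((x.1 : ℂ) * f x)) • A v +
      ((β : ℂ) * ((x.2 : ℂ) * (-Complex.I * ħ * deriv (fun q : ℝ => f (q, x.2)) x.1))) • v)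

/-- `V t = exp(-i t H_M / ħ)`: a strongly continuous one-parameter unitary group whose generator
extends `-(i/ħ) H_M`. -/
structure IsEvolution (ħ α β : ℝ) (A : H →ₗ[ℂ] H)
    (V : ℝ → (Total H μ ≃ₗᵢ[ℂ] Total H μ)) : Prop where
  add : ∀ (s t : ℝ) (Ψ : Total H μ), V (s + t) Ψ = V s (V t Ψ)
  continuous : ∀ Ψ : Total H μ, Continuous fun t => V t Ψ
  deriv : ∀ Ψ X : Total H μ, MeasHamiltonian ħ α β A Ψ X →
    HasDerivAt (fun t => V t Ψ) ((-Complex.I / (ħ : ℂ)) • X) 0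

end Dynamics

/-- `f` is of exponential type `τ`: `|f z| < exp (τ |z|)` for all sufficiently large `|z|`. -/
def IsExponentialType (τ : ℝ) (f : ℂ → ℂ) : Prop :=
  ∃ R : ℝ, ∀ z : ℂ, R < ‖z‖ → ‖f z‖ < Real.exp (τ * ‖z‖)

/-- A wave function is momentum limited, with bound `κ`, if it is
`x ↦ ∫_{-κ}^{κ} exp(i x k) g(k) dk` for a square integrable `g`. -/
def IsMomentumLimited (κ : ℝ) (Ψ : Probe) : Prop :=
  0 < κ ∧ ∃ g : ℝ → ℂ, MemLp g 2 (volume.restrict (Set.Icc (-κ) κ)) ∧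
    Ψ =ᵐ[volume] fun x : ℝ => ∫ k in (-κ)..κ, Complex.exp (Complex.I * x * k) * g k

/-- The integrand of the coherence kernel. -/
def coherenceIntegrand (ħ α lam : ℝ) (Ψ : Probe) (ak al b b' q : ℝ) : ℂ :=
  Complex.exp (Complex.I / ħ * α * q * (ak - al)) *
    Ψ (q - 2 * lam * b / α) * conj (Ψ (q - 2 * lam * b' / α))

/-- The coherence kernel `I_{kl}(b, b')`, for eigenvalues `ak` and `al`. -/
def coherenceKernel (ħ α lam : ℝ) (Ψ : Probe) (ak al b b' : ℝ) : ℂ :=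
  ∫ q : ℝ, coherenceIntegrand ħ α lam Ψ ak al b b' q

/-- The momentum wave function `⟨p|Ψ⟩ = (2πħ)^{-1/2} ∫ exp(-i p q / ħ) Ψ(q) dq`; the Fourier
transform of `L²(ℝ)` used here is the unitary one with kernel `exp(-2π i ξ q)`. -/
def momentumWave (ħ : ℝ) (Ψ : Probe) (p : ℝ) : ℂ :=
  ((1 / Real.sqrt (2 * Real.pi * ħ) : ℝ) : ℂ) * (𝓕 Ψ : Probe) (p / (2 * Real.pi * ħ))

theorem memLp_phase {μ : Measure ℝ} (s : ℝ) (Φ : Pointer μ) :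
    MemLp (fun b : ℝ => Complex.exp (Complex.I * s * b) * Φ b) 2 μ := by
  refine (Lp.memLp Φ).of_le ?_ (Filter.Eventually.of_forall fun b => ?_)
  · exact (Continuous.aestronglyMeasurable (by fun_prop)).mul (Lp.memLp Φ).1
  · have h : Complex.I * s * b = ((s * b : ℝ) : ℂ) * Complex.I := by push_cast; ring
    rw [norm_mul, h, Complex.norm_exp_ofReal_mul_I, one_mul]

/-- `exp(i s B) Φ`. -/
def phase {μ : Measure ℝ} (s : ℝ) (Φ : Pointer μ) : Pointer μ := (memLp_phase s Φ).toLp _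

/-- The pointer state that belongs to the eigenvalue `ak`:
`∫ |⟨p|Ψ⟩|² e^{(i/ħ)(α ak / 2 - p) β B} |Φ⟩⟨Φ| e^{-(i/ħ)(α ak / 2 - p) β B} dp`. -/
def pointerState {μ : Measure ℝ} (ħ α β : ℝ) (Ψ : Probe) (Φ : Pointer μ) (ak : ℝ) :
    Pointer μ →L[ℂ] Pointer μ :=
  ∫ p : ℝ, ‖momentumWave ħ Ψ p‖ ^ 2 •
    InnerProductSpace.rankOne ℂ (phase ((α * ak / 2 - p) * β / ħ) Φ)
      (phase ((α * ak / 2 - p) * β / ħ) Φ)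

end ProbeMeasurement

end

/-! A momentum limited `Ψ` is the inverse Fourier transform of an amplitude `h` supported in `|2πξ|
≤ κ₀`. Multiplication by `exp(iαq(a_k - a_l)/ħ)` translates an amplitude, while a translation in `q`
only multiplies it by a phase. The bound on `α` says that the smallest such translation, `αa₀/ħ` in
units of `2πξ`, exceeds the band width `2κ₀`. Amplitudes of different eigenvalues are then
disjointly supported, and Parseval's identity kills the coherence kernels (`mul_eq_zero_of_band`,
`coherenceKernel_eq_zero`). The entire extension is the same Fourier integral at complex argument;
its growth depends on `Im z` alone.

The Hamiltonian is diagonal in `φ_k` and of first order in `q`, so the Schrödinger equation is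
solved by characteristics: transport along a shear, times a phase for each `k` (`evolveFun`). This
is a unitary group that leaves invariant a dense core of test functions times eigenvectors. Any
other evolution has the same derivative along orbits in the core, hence equals it
(`group_apply_eq_of_hasDerivAt`, `IsEvolution.eq_evolve`).

Pairing the final state with `u` over system and pointer leaves a probe vector `g u`, and Parseval
in a probe basis turns the partial trace into `⟨g v, g u⟩`. The amplitude of `g u` is a sum over `k`
of translates of `h` times an overlap with a phase-shifted `Φ`. Disjointness of the translates
removes the cross terms (`integral_probeAmplitude_mul_conj`), and the diagonal terms are the matrix
elements of `ρ_k`. -/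

namespace ProbeMeasurement

/-! ### Fourier inversion and Parseval on `L¹ ∩ L²`. -/

section FourierInversion

theorem continuous_fourierInv {h : ℝ → ℂ} (h1 : Integrable h) : Continuous (𝓕⁻ h) :=
  VectorFourier.fourierIntegral_continuous Real.continuous_fourierChar
    (continuous_inner (𝕜 := ℝ) (E := ℝ)).neg h1

/-- On `L¹ ∩ L²` the inverse Fourier transform of `L²` is given by the Fourier integral. -/
theorem coeFn_fourierInv_toLp {h : ℝ → ℂ} (h1 : Integrable h) (h2 : MemLp h 2 volume) :
    ((𝓕⁻ (h2.toLp h) : Probe) : ℝ → ℂ) =ᵐ[volume] 𝓕⁻ h := by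
  -- Both sides are locally integrable, so test functions separate them. These are Schwartz
  -- functions, and the transform of `L²` is dual to the Schwartz one.
  refine ae_eq_of_integral_contDiff_smul_eq ((Lp.memLp _).locallyIntegrable one_le_two)
    (continuous_fourierInv h1).locallyIntegrable fun g hg hgc => ?_
  have hgC : ContDiff ℝ ∞ (fun x => (g x : ℂ)) := Complex.ofRealCLM.contDiff.comp hg
  have hgCc : HasCompactSupport (fun x => (g x : ℂ)) := hgc.comp_left Complex.ofReal_zero
  let G : SchwartzMap ℝ ℂ := hgCc.toSchwartzMap hgC
  have hG : ∀ x, G x = (g x : ℂ) := fun x => rfl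
  have key := congrArg (fun T => T G) (Lp.fourierInv_toTemperedDistribution_eq (h2.toLp h))
  simp only [TemperedDistribution.fourierInv_apply, Lp.toTemperedDistribution_apply] at key
  have e1 : ∫ x, g x • (𝓕⁻ (h2.toLp h) : Probe) x =
      ∫ x, G x • (𝓕⁻ (h2.toLp h) : Probe) x := by
    refine integral_congr_ae (Filter.Eventually.of_forall fun x => ?_)
    simp [hG]
  have e2 : ∫ x, g x • 𝓕⁻ h x = ∫ x, G x • 𝓕⁻ h x := by
    refine integral_congr_ae (Filter.Eventually.of_forall fun x => ?_)
    simp [hG]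
  have e3 : ∫ x, (𝓕⁻ G) x • (h2.toLp h) x = ∫ x, 𝓕⁻ (G : ℝ → ℂ) x • h x := by
    refine integral_congr_ae ?_
    filter_upwards [h2.coeFn_toLp] with x hx
    rw [hx, SchwartzMap.fourierInv_coe]
  -- Fubini moves the transform across the pairing; the kernel is symmetric in its two variables.
  have e4 : ∫ x, 𝓕⁻ (G : ℝ → ℂ) x • h x = ∫ x, G x • 𝓕⁻ h x := by
    have := VectorFourier.integral_fourierIntegral_smul_eq_flip (L := -innerₗ ℝ)
      Real.continuous_fourierChar (continuous_inner (𝕜 := ℝ) (E := ℝ)).neg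
      (G.integrable (μ := volume)) h1
    have hflip : (-innerₗ ℝ).flip = -innerₗ ℝ := by
      ext; simp
    rw [hflip] at this
    exact this
  rw [e1, ← key, e3, e4, ← e2]

theorem memLp_fourierInv {h : ℝ → ℂ} (h1 : Integrable h) (h2 : MemLp h 2 volume) :
    MemLp (𝓕⁻ h) 2 volume :=
  (Lp.memLp (𝓕⁻ (h2.toLp h) : Probe)).ae_eq (coeFn_fourierInv_toLp h1 h2)

theorem inner_fourierInv (f g : Probe) : inner ℂ (𝓕⁻ f) (𝓕⁻ g) = inner ℂ f g :=
  (Lp.fourierTransformₗᵢ ℝ ℂ).symm.inner_map_map f g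

theorem integrable_mul_conj {X : Type*} [MeasurableSpace X] {μ : Measure X} {f g : X → ℂ}
    (hf : MemLp f 2 μ) (hg : MemLp g 2 μ) : Integrable (fun x => f x * conj (g x)) μ :=
  hf.integrable_mul hg.star

/-- Parseval's identity for functions in `L¹ ∩ L²`. -/
theorem integral_fourierInv_mul_conj {f g : ℝ → ℂ} (f1 : Integrable f) (f2 : MemLp f 2 volume)
    (g1 : Integrable g) (g2 : MemLp g 2 volume) :
    ∫ x, 𝓕⁻ f x * conj (𝓕⁻ g x) = ∫ ξ, f ξ * conj (g ξ) := by
  have key := inner_fourierInv (g2.toLp g) (f2.toLp f)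
  rw [L2.inner_def, L2.inner_def] at key
  calc ∫ x, 𝓕⁻ f x * conj (𝓕⁻ g x)
      = ∫ x, inner ℂ ((𝓕⁻ (g2.toLp g) : Probe) x) ((𝓕⁻ (f2.toLp f) : Probe) x) := by
        refine integral_congr_ae ?_
        filter_upwards [coeFn_fourierInv_toLp f1 f2, coeFn_fourierInv_toLp g1 g2] with x hx hy
        rw [hx, hy, RCLike.inner_apply]
    _ = ∫ ξ, f ξ * conj (g ξ) := by
        rw [key]
        refine integral_congr_ae ?_
        filter_upwards [f2.coeFn_toLp, g2.coeFn_toLp] with x hx hy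
        rw [hx, hy, RCLike.inner_apply]

/-- The inverse Fourier transform turns a modulation and a translation into a translation and a
modulation. -/
theorem fourierInv_modulate_translate (h : ℝ → ℂ) (c s x : ℝ) :
    𝓕⁻ (fun ξ => Complex.exp (-(2 * Real.pi * c * (ξ - s) : ℝ) * Complex.I) * h (ξ - s)) x =
      Complex.exp ((2 * Real.pi * s * x : ℝ) * Complex.I) * 𝓕⁻ h (x - c) := by
  rw [Real.fourierInv_eq', Real.fourierInv_eq', ← integral_const_mul,
    ← integral_add_right_eq_self _ s]
  refine integral_congr_ae (Filter.Eventually.of_forall fun ξ => ?_)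
  simp only [add_sub_cancel_right, RCLike.inner_apply, conj_trivial, smul_eq_mul, ← mul_assoc, ← Complex.exp_add]
  congr 2
  push_cast
  ring

theorem integrable_modulate_translate {h : ℝ → ℂ} (h1 : Integrable h) (c s : ℝ) :
    Integrable fun ξ : ℝ =>
      Complex.exp (-(2 * Real.pi * c * (ξ - s) : ℝ) * Complex.I) * h (ξ - s) := by
  refine (h1.comp_sub_right s).bdd_mul (c := 1) (Continuous.aestronglyMeasurable (by fun_prop)) ?_
  refine Filter.Eventually.of_forall fun ξ => ?_
  rw [← Complex.ofReal_neg, Complex.norm_exp_ofReal_mul_I]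

theorem memLp_modulate_translate {h : ℝ → ℂ} (h2 : MemLp h 2 volume) (c s : ℝ) :
    MemLp (fun ξ : ℝ =>
      Complex.exp (-(2 * Real.pi * c * (ξ - s) : ℝ) * Complex.I) * h (ξ - s)) 2 volume := by
  have h3 : MemLp (fun ξ => h (ξ - s)) 2 volume :=
    h2.comp_measurePreserving (measurePreserving_sub_right volume s)
  refine h3.of_le ((Continuous.aestronglyMeasurable (by fun_prop)).mul h3.1)
    (Filter.Eventually.of_forall fun ξ => ?_)
  rw [norm_mul, ← Complex.ofReal_neg, Complex.norm_exp_ofReal_mul_I, one_mul]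

end FourierInversion

/-! ### Band limited functions: entire extension and exponential type. -/

section BandLimited

/-- The spectral amplitude of a momentum limited wave function. -/
theorem IsMomentumLimited.exists_amplitude {κ : ℝ} {Ψ : Probe} (hΨ : IsMomentumLimited κ Ψ) :
    ∃ h : ℝ → ℂ, Integrable h ∧ MemLp h 2 volume ∧ (∀ ξ, κ < |2 * Real.pi * ξ| → h ξ = 0) ∧
      Ψ =ᵐ[volume] 𝓕⁻ h := by
  obtain ⟨hκ, g, hg, hΨg⟩ := hΨ
  have hpi : (2 * Real.pi) ≠ 0 := by positivity
  let G : ℝ → ℂ := (Set.Icc (-κ) κ).indicator g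
  have hG2 : MemLp G 2 volume := (memLp_indicator_iff_restrict measurableSet_Icc).2 hg
  have hG1 : Integrable G :=
    (integrable_indicator_iff measurableSet_Icc).2 (hg.integrable one_le_two)
  -- The substitution `k = 2πξ` passes to the kernel `exp(2πiξx)`; the factor `2π` is its Jacobian.
  refine ⟨fun ξ => (2 * Real.pi : ℝ) • G (2 * Real.pi * ξ), ?_, ?_, ?_, ?_⟩
  · exact (hG1.comp_mul_left' hpi).smul (2 * Real.pi)
  · refine MemLp.const_smul (f := fun ξ => G (2 * Real.pi * ξ)) ?_ (2 * Real.pi)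
    have hm : AEStronglyMeasurable (fun ξ => G (2 * Real.pi * ξ)) volume :=
      (hG1.comp_mul_left' hpi).1
    rw [memLp_two_iff_integrable_sq_norm hm]
    exact Integrable.comp_mul_left' ((memLp_two_iff_integrable_sq_norm hG2.1).1 hG2) hpi
  · intro ξ hξ
    have : 2 * Real.pi * ξ ∉ Set.Icc (-κ) κ := fun h => not_lt.2 (abs_le.2 h) hξ
    simp [G, this]
  · refine hΨg.trans (Filter.Eventually.of_forall fun x => ?_)
    dsimp only
    rw [Real.fourierInv_eq', intervalIntegral.integral_of_le (by linarith),
      ← integral_Icc_eq_integral_Ioc, ← integral_indicator measurableSet_Icc]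
    let F : ℝ → ℂ := fun k => Complex.exp (Complex.I * x * k) * G k
    have := Measure.integral_comp_mul_left F (2 * Real.pi)
    have hF : (Set.Icc (-κ) κ).indicator (fun k : ℝ => Complex.exp (Complex.I * x * k) * g k) = F := by
      funext k
      by_cases hk : k ∈ Set.Icc (-κ) κ <;> simp [F, G, hk]
    rw [hF]
    have h3 : ∫ k, F k = (2 * Real.pi : ℝ) • ∫ k, F (2 * Real.pi * k) := by
      rw [this, smul_smul, abs_of_pos (by positivity), mul_inv_cancel₀ hpi, one_smul]
    rw [h3, ← integral_smul]
    refine integral_congr_ae (Filter.Eventually.of_forall fun ξ => ?_)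
    simp only [F, RCLike.inner_apply, conj_trivial, smul_eq_mul, Complex.real_smul]
    have : Complex.I * x * ((2 * Real.pi * ξ : ℝ) : ℂ) =
      ((2 * Real.pi * (x * ξ) : ℝ) : ℂ) * Complex.I := by push_cast; ring
    rw [this]
    ring

/-- The entire function `z ↦ ∫ exp (2 π i ξ z) h ξ dξ`. -/
noncomputable def entireExtension (h : ℝ → ℂ) (z : ℂ) : ℂ :=
  ∫ ξ : ℝ, Complex.exp ((2 * Real.pi * ξ : ℝ) * z * Complex.I) * h ξ

theorem entireExtension_ofReal (h : ℝ → ℂ) (x : ℝ) : entireExtension h x = 𝓕⁻ h x := by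
  rw [entireExtension, Real.fourierInv_eq']
  refine integral_congr_ae (Filter.Eventually.of_forall fun ξ => ?_)
  simp only [RCLike.inner_apply, conj_trivial, smul_eq_mul]
  congr 3
  push_cast
  ring

variable {h : ℝ → ℂ} {κ : ℝ}

theorem norm_exp_mul_le (h : ℝ → ℂ) (z : ℂ) (ξ : ℝ) :
    ‖Complex.exp ((2 * Real.pi * ξ : ℝ) * z * Complex.I) * h ξ‖ ≤
      Real.exp (|z.im| * |2 * Real.pi * ξ|) * ‖h ξ‖ := by
  rw [norm_mul, Complex.norm_exp]
  gcongr
  have : ((2 * Real.pi * ξ : ℝ) * z * Complex.I).re = -(z.im * (2 * Real.pi * ξ)) := by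
    rw [Complex.mul_I_re, Complex.im_ofReal_mul]; ring
  rw [this, ← abs_mul]
  exact neg_le_abs _

theorem integrable_exp_mul (h1 : Integrable h) (hs : ∀ ξ, κ < |2 * Real.pi * ξ| → h ξ = 0)
    (z : ℂ) : Integrable fun ξ : ℝ => Complex.exp ((2 * Real.pi * ξ : ℝ) * z * Complex.I) * h ξ := by
  refine (h1.norm.const_mul (Real.exp (|z.im| * κ))).mono'
    ((Continuous.aestronglyMeasurable (by fun_prop)).mul h1.1)
    (Filter.Eventually.of_forall fun ξ => (norm_exp_mul_le h z ξ).trans ?_)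
  by_cases hξ : κ < |2 * Real.pi * ξ|
  · simp [hs ξ hξ]
  · gcongr; exact not_lt.1 hξ

/-- Differentiation under the integral: on a unit ball the bounded frequencies dominate the
derivative by a constant times `‖h ξ‖`. -/
theorem differentiable_entireExtension (h1 : Integrable h)
    (hs : ∀ ξ, κ < |2 * Real.pi * ξ| → h ξ = 0) : Differentiable ℂ (entireExtension h) := by
  intro z₀
  have := hasDerivAt_integral_of_dominated_loc_of_deriv_le (μ := volume) (x₀ := z₀)
    (s := Metric.ball z₀ 1)
    (F := fun z ξ => Complex.exp ((2 * Real.pi * ξ : ℝ) * z * Complex.I) * h ξ)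
    (F' := fun z ξ => Complex.exp ((2 * Real.pi * ξ : ℝ) * z * Complex.I) *
      ((2 * Real.pi * ξ : ℝ) * Complex.I) * h ξ)
    (bound := fun ξ => Real.exp ((‖z₀‖ + 1) * κ) * κ * ‖h ξ‖)
    (Metric.ball_mem_nhds z₀ one_pos)
    (Filter.Eventually.of_forall fun z =>
      (Continuous.aestronglyMeasurable (by fun_prop)).mul h1.1)
    (integrable_exp_mul h1 hs z₀)
    ((Continuous.aestronglyMeasurable (by fun_prop)).mul h1.1)
    (Filter.Eventually.of_forall fun ξ z hz => ?_)
    (h1.norm.const_mul _)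
    (Filter.Eventually.of_forall fun ξ z _ => ?_)
  · exact this.2.differentiableAt
  · by_cases hξ : κ < |2 * Real.pi * ξ|
    · simp [hs ξ hξ]
    · have hξ := not_lt.1 hξ
      have hz1 : |z.im| ≤ ‖z₀‖ + 1 := by
        refine (Complex.abs_im_le_norm z).trans ?_
        have := norm_sub_norm_le z z₀
        rw [mem_ball_iff_norm] at hz
        linarith
      have hn := norm_exp_mul_le (fun ξ => ((2 * Real.pi * ξ : ℝ) * Complex.I) * h ξ) z ξ
      rw [mul_assoc]
      refine hn.trans ?_
      rw [norm_mul, norm_mul, Complex.norm_I, mul_one, Complex.norm_real, Real.norm_eq_abs,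
        ← mul_assoc]
      gcongr
  · refine HasDerivAt.mul_const ?_ _
    have h2 : HasDerivAt (fun z : ℂ => ((2 * Real.pi * ξ : ℝ) : ℂ) * z * Complex.I)
        (((2 * Real.pi * ξ : ℝ) : ℂ) * Complex.I) z := by
      simpa using ((hasDerivAt_id z).const_mul ((2 * Real.pi * ξ : ℝ) : ℂ)).mul_const Complex.I
    exact h2.cexp

theorem norm_entireExtension_le (h1 : Integrable h)
    (hs : ∀ ξ, κ < |2 * Real.pi * ξ| → h ξ = 0) (z : ℂ) :
    ‖entireExtension h z‖ ≤ Real.exp (κ * |z.im|) * ∫ ξ, ‖h ξ‖ := by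
  rw [← integral_const_mul]
  refine norm_integral_le_of_norm_le (h1.norm.const_mul _)
    (Filter.Eventually.of_forall fun ξ => (norm_exp_mul_le h z ξ).trans ?_)
  by_cases hξ : κ < |2 * Real.pi * ξ|
  · simp [hs ξ hξ]
  · rw [mul_comm κ]; gcongr; exact not_lt.1 hξ

/-- Off a horizontal strip the bound is strict: the amplitude has no mass at the edges of the
band. -/
theorem exists_norm_entireExtension_lt (h1 : Integrable h)
    (hs : ∀ ξ, κ < |2 * Real.pi * ξ| → h ξ = 0) :
    ∃ Y : ℝ, ∀ z : ℂ, Y ≤ |z.im| → ‖entireExtension h z‖ < Real.exp (κ * |z.im|) := by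
  have hlim : Filter.Tendsto
      (fun r : ℝ => ∫ ξ, Real.exp (-(r * (κ - |2 * Real.pi * ξ|))) * ‖h ξ‖) Filter.atTop
      (nhds (∫ _ : ℝ, (0 : ℝ))) := by
    refine tendsto_integral_filter_of_dominated_convergence (fun ξ => ‖h ξ‖)
      (Filter.Eventually.of_forall fun r =>
        (Continuous.aestronglyMeasurable (by fun_prop)).mul h1.1.norm) ?_ h1.norm ?_
    · filter_upwards [Filter.eventually_ge_atTop 0] with r hr
      refine Filter.Eventually.of_forall fun ξ => ?_
      by_cases hξ : κ < |2 * Real.pi * ξ|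
      · simp [hs ξ hξ]
      · rw [norm_mul, norm_norm, Real.norm_eq_abs, Real.abs_exp]
        refine mul_le_of_le_one_left (norm_nonneg _) (Real.exp_le_one_iff.2 ?_)
        have := mul_nonneg hr (sub_nonneg.2 (not_lt.1 hξ))
        linarith
    -- The factor fails to decay only at the two edges `2πξ = ±κ`, which form a null set.
    · have hne : ∀ c : ℝ, ∀ᵐ ξ : ℝ, ξ ≠ c := fun c => by
        simp [ae_iff]
      filter_upwards [hne (κ / (2 * Real.pi)), hne (-κ / (2 * Real.pi))] with ξ hξ1 hξ2
      rcases lt_trichotomy κ |2 * Real.pi * ξ| with hξ | hξ | hξ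
      · simp [hs ξ hξ]
      · exfalso
        have hpi : (2 * Real.pi) ≠ 0 := by positivity
        rcases abs_choice (2 * Real.pi * ξ) with h' | h'
        · exact hξ1 (by rw [hξ, h']; field_simp)
        · exact hξ2 (by rw [hξ, h']; field_simp)
      · have : Filter.Tendsto (fun r : ℝ => Real.exp (-(r * (κ - |2 * Real.pi * ξ|))))
            Filter.atTop (nhds 0) :=
          Real.tendsto_exp_neg_atTop_nhds_zero.comp
            (Filter.tendsto_id.atTop_mul_const (sub_pos.2 hξ))
        simpa using this.mul_const ‖h ξ‖
  rw [integral_zero] at hlim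
  obtain ⟨Y, hY⟩ := Filter.eventually_atTop.1 (hlim.eventually (gt_mem_nhds one_pos))
  refine ⟨Y, fun z hz => ?_⟩
  have hb : ‖entireExtension h z‖ ≤
      ∫ ξ, Real.exp (|z.im| * |2 * Real.pi * ξ|) * ‖h ξ‖ := by
    refine norm_integral_le_of_norm_le ?_
      (Filter.Eventually.of_forall fun ξ => norm_exp_mul_le h z ξ)
    refine (h1.norm.const_mul (Real.exp (|z.im| * κ))).mono'
      ((Continuous.aestronglyMeasurable (by fun_prop)).mul h1.1.norm)
      (Filter.Eventually.of_forall fun ξ => ?_)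
    rw [Real.norm_of_nonneg (by positivity)]
    by_cases hξ : κ < |2 * Real.pi * ξ|
    · simp [hs ξ hξ]
    · gcongr; exact not_lt.1 hξ
  have hfac : ∫ ξ, Real.exp (|z.im| * |2 * Real.pi * ξ|) * ‖h ξ‖ =
      Real.exp (κ * |z.im|) *
        ∫ ξ, Real.exp (-(|z.im| * (κ - |2 * Real.pi * ξ|))) * ‖h ξ‖ := by
    rw [← integral_const_mul]
    refine integral_congr_ae (Filter.Eventually.of_forall fun ξ => ?_)
    dsimp only
    rw [← mul_assoc, ← Real.exp_add]
    congr 2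
    ring
  rw [hfac] at hb
  exact hb.trans_lt (mul_lt_of_lt_one_right (Real.exp_pos _) (hY _ hz))

/-- Off the strip `|Im z| ≤ |z|` suffices; inside it `F` is bounded, and `exp(τ|z|)` outgrows any
constant. -/
theorem isExponentialType_of_im {τ Y D : ℝ} (hτ : 0 < τ) {F : ℂ → ℂ}
    (hY : ∀ z : ℂ, Y ≤ |z.im| → ‖F z‖ < Real.exp (τ * |z.im|))
    (hD : ∀ z : ℂ, |z.im| ≤ Y → ‖F z‖ ≤ D) : IsExponentialType τ F := by
  -- Beyond this radius `exp(τ|z|) > |D| + 1 > D`.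
  refine ⟨Real.log (|D| + 1) / τ, fun z hz => ?_⟩
  rcases le_total Y |z.im| with h | h
  · refine (hY z h).trans_le (Real.exp_le_exp.2 ?_)
    gcongr
    exact Complex.abs_im_le_norm z
  · have h0 : 0 < |D| + 1 := by positivity
    rw [div_lt_iff₀ hτ, mul_comm, Real.log_lt_iff_lt_exp h0] at hz
    linarith [hD z h, le_abs_self D]

theorem isExponentialType_entireExtension (hκ : 0 < κ) (h1 : Integrable h)
    (hs : ∀ ξ, κ < |2 * Real.pi * ξ| → h ξ = 0) : IsExponentialType κ (entireExtension h) := by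
  obtain ⟨Y, hY⟩ := exists_norm_entireExtension_lt h1 hs
  refine isExponentialType_of_im hκ hY (D := Real.exp (κ * Y) * ∫ ξ, ‖h ξ‖) fun z hz =>
    (norm_entireExtension_le h1 hs z).trans ?_
  gcongr

/-- Real shifts and conjugation preserve `|Im z|`, so the bounds for the single factors multiply,
still strictly and on the same strip. -/
theorem isExponentialType_entireExtension_mul (hκ : 0 < κ) (h1 : Integrable h)
    (hs : ∀ ξ, κ < |2 * Real.pi * ξ| → h ξ = 0) (c c' : ℝ) :
    IsExponentialType (2 * κ) fun z : ℂ =>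
      entireExtension h (z - c) * conj (entireExtension h (conj z - c')) := by
  obtain ⟨Y, hY⟩ := exists_norm_entireExtension_lt h1 hs
  have i1 : ∀ z : ℂ, |(z - c).im| = |z.im| := fun z => by simp
  have i2 : ∀ z : ℂ, |(conj z - c').im| = |z.im| := fun z => by simp
  refine isExponentialType_of_im (by positivity) (Y := Y)
    (D := (Real.exp (κ * Y) * ∫ ξ, ‖h ξ‖) * (Real.exp (κ * Y) * ∫ ξ, ‖h ξ‖)) ?_ ?_
  · intro z hz
    have a1 := hY (z - c) ((i1 z).symm ▸ hz)
    have a2 := hY (conj z - c') ((i2 z).symm ▸ hz)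
    rw [i1] at a1
    rw [i2] at a2
    rw [norm_mul, RCLike.norm_conj, mul_assoc, two_mul, Real.exp_add]
    exact mul_lt_mul'' a1 a2 (norm_nonneg _) (norm_nonneg _)
  · intro z hz
    have hn : 0 ≤ ∫ ξ, ‖h ξ‖ := integral_nonneg fun _ => norm_nonneg _
    have a1 := norm_entireExtension_le h1 hs (z - c)
    have a2 := norm_entireExtension_le h1 hs (conj z - c')
    rw [i1] at a1
    rw [i2] at a2
    rw [norm_mul, RCLike.norm_conj]
    refine mul_le_mul (a1.trans ?_) (a2.trans ?_) (norm_nonneg _) (by positivity) <;> gcongr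

theorem differentiable_entireExtension_mul (h1 : Integrable h)
    (hs : ∀ ξ, κ < |2 * Real.pi * ξ| → h ξ = 0) (c c' : ℝ) :
    Differentiable ℂ fun z : ℂ =>
      entireExtension h (z - c) * conj (entireExtension h (conj z - c')) := by
  have hd := differentiable_entireExtension h1 hs
  refine (hd.comp (differentiable_id.sub_const _)).mul fun z => ?_
  have := (hd.comp (differentiable_id.sub_const (c' : ℂ)) (conj z)).conj_conj
  rw [Complex.conj_conj] at this
  exact this

end BandLimited

/-! ### Vanishing of the coherence kernels. -/

section Coherence

variable {h : ℝ → ℂ} {κ : ℝ}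

/-- Puts the integrand in the form required by Parseval. The eigenvalue phase is attached to the
first factor, as a frequency shift; the pointer values enter only through modulations. -/
theorem coherenceIntegrand_ae_eq {Ψ : Probe} (hΨ : Ψ =ᵐ[volume] 𝓕⁻ h) (ħ α lam ak al b b' : ℝ) :
    coherenceIntegrand ħ α lam Ψ ak al b b' =ᵐ[volume] fun q =>
      𝓕⁻ (fun ξ => Complex.exp (-(2 * Real.pi * (2 * lam * b / α) *
          (ξ - α * (ak - al) / (2 * Real.pi * ħ)) : ℝ) * Complex.I) *
          h (ξ - α * (ak - al) / (2 * Real.pi * ħ))) q *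
        conj (𝓕⁻ (fun ξ => Complex.exp (-(2 * Real.pi * (2 * lam * b' / α) * (ξ - 0) : ℝ) *
          Complex.I) * h (ξ - 0)) q) := by
  have t := fun c : ℝ =>
    (measurePreserving_sub_right (volume : Measure ℝ) c).quasiMeasurePreserving.ae_eq_comp hΨ
  filter_upwards [t (2 * lam * b / α), t (2 * lam * b' / α)] with q h1 h2
  simp only [Function.comp_apply] at h1 h2
  rw [fourierInv_modulate_translate, fourierInv_modulate_translate, coherenceIntegrand, h1, h2]
  have : Complex.I / ħ * α * q * (ak - al) =
      ((2 * Real.pi * (α * (ak - al) / (2 * Real.pi * ħ)) * q : ℝ) : ℂ) * Complex.I := by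
    have hpi : (Real.pi : ℂ) ≠ 0 := by exact_mod_cast Real.pi_ne_zero
    push_cast
    field_simp
  rw [this]
  simp

theorem integrable_coherenceIntegrand {Ψ : Probe} (h1 : Integrable h) (h2 : MemLp h 2 volume)
    (hΨ : Ψ =ᵐ[volume] 𝓕⁻ h) (ħ α lam ak al b b' : ℝ) :
    Integrable (coherenceIntegrand ħ α lam Ψ ak al b b') :=
  (integrable_mul_conj
    (memLp_fourierInv (integrable_modulate_translate h1 _ _) (memLp_modulate_translate h2 _ _))
    (memLp_fourierInv (integrable_modulate_translate h1 _ _)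
      (memLp_modulate_translate h2 _ _))).congr (coherenceIntegrand_ae_eq hΨ ..).symm

/-- Two translates of a band limited amplitude by more than the band width are disjoint. -/
theorem mul_eq_zero_of_band (hs : ∀ ξ, κ < |2 * Real.pi * ξ| → h ξ = 0) {s t : ℝ}
    (hst : 2 * κ < 2 * Real.pi * |s - t|) (ξ : ℝ) : h (ξ - s) * conj (h (ξ - t)) = 0 := by
  by_cases h1 : κ < |2 * Real.pi * (ξ - s)|
  · simp [hs _ h1]
  by_cases h2 : κ < |2 * Real.pi * (ξ - t)|
  · simp [hs _ h2]
  exfalso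
  -- If both points lay in the band, the triangle inequality would give `2π|s - t| ≤ 2κ`.
  have h3 := abs_sub (2 * Real.pi * (ξ - t)) (2 * Real.pi * (ξ - s))
  have h4 : 2 * Real.pi * (ξ - t) - 2 * Real.pi * (ξ - s) = 2 * Real.pi * (s - t) := by ring
  rw [h4, abs_mul, abs_of_pos (show 0 < 2 * Real.pi by positivity)] at h3
  linarith [not_lt.1 h1, not_lt.1 h2]

theorem coherenceKernel_eq_zero {Ψ : Probe} (h1 : Integrable h) (h2 : MemLp h 2 volume)
    (hs : ∀ ξ, κ < |2 * Real.pi * ξ| → h ξ = 0) (hΨ : Ψ =ᵐ[volume] 𝓕⁻ h) {ħ α ak al : ℝ}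
    (hgap : 2 * κ < 2 * Real.pi * |α * (ak - al) / (2 * Real.pi * ħ)|) (lam b b' : ℝ) :
    coherenceKernel ħ α lam Ψ ak al b b' = 0 := by
  rw [coherenceKernel, integral_congr_ae (coherenceIntegrand_ae_eq hΨ ..),
    integral_fourierInv_mul_conj (integrable_modulate_translate h1 _ _)
      (memLp_modulate_translate h2 _ _) (integrable_modulate_translate h1 _ _)
      (memLp_modulate_translate h2 _ _)]
  refine integral_eq_zero_of_ae (Filter.Eventually.of_forall fun ξ => ?_)
  have := mul_eq_zero_of_band hs (s := α * (ak - al) / (2 * Real.pi * ħ)) (t := 0)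
    (by simpa using hgap) ξ
  simp only [map_mul, Pi.zero_apply]
  rw [mul_mul_mul_comm, this, mul_zero]

/-- The right side is `|α| |a_k - a_l| / ħ`, and distinct eigenvalues differ by at least `a₀`, so
this is the threshold condition on `α`. -/
theorem band_lt_gap {ι : Type*} {a : ι → ℝ} (ha : Function.Injective a) {a₀ : ℝ}
    (ha₀ : IsLeast {d : ℝ | ∃ k l, a l < a k ∧ d = a k - a l} a₀) {ħ κ₀ α : ℝ} (hħ : 0 < ħ)
    (hα : 2 * ħ * κ₀ / a₀ < α) {k l : ι} (hkl : k ≠ l) :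
    2 * κ₀ < 2 * Real.pi * |α * (a k - a l) / (2 * Real.pi * ħ)| := by
  have h0 : 0 < a₀ := by
    obtain ⟨i, j, hij, h⟩ := ha₀.1
    linarith
  have h1 : a₀ ≤ |a k - a l| := by
    rcases lt_or_gt_of_ne (ha.ne hkl) with h | h
    · rw [abs_sub_comm]
      exact (ha₀.2 ⟨l, k, h, rfl⟩).trans (le_abs_self _)
    · exact (ha₀.2 ⟨k, l, h, rfl⟩).trans (le_abs_self _)
  rw [div_lt_iff₀ h0] at hα
  have h2 : 2 * Real.pi * |α * (a k - a l) / (2 * Real.pi * ħ)| = |α| * |a k - a l| / ħ := by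
    rw [abs_div, abs_mul, abs_of_pos (show 0 < 2 * Real.pi * ħ by positivity)]
    field_simp
  rw [h2, lt_div_iff₀ hħ]
  have h3 : α * a₀ ≤ |α| * |a k - a l| :=
    mul_le_mul (le_abs_self α) h1 h0.le (abs_nonneg α)
  linarith

end Coherence

/-! ### One-parameter groups of isometries. -/

section OneParameterGroups

variable {E : Type*} [NormedAddCommGroup E] [NormedSpace ℂ E]

theorem group_zero {V : ℝ → (E ≃ₗᵢ[ℂ] E)} (hV : ∀ s t x, V (s + t) x = V s (V t x)) (x : E) :
    V 0 x = x := by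
  have := hV 0 0 x
  rw [add_zero] at this
  exact ((V 0).injective this).symm

/-- Two one-parameter groups of isometries agree on an orbit along which their generators agree. -/
theorem group_apply_eq_of_hasDerivAt {V W : ℝ → (E ≃ₗᵢ[ℂ] E)}
    (hV : ∀ s t x, V (s + t) x = V s (V t x)) (hW : ∀ s t x, W (s + t) x = W s (W t x)) {x : E}
    (h : ∀ t, ∃ y, HasDerivAt (fun s => V s (V t x)) y 0 ∧ HasDerivAt (fun s => W s (V t x)) y 0)
    (t : ℝ) : V t x = W t x := by
  -- It suffices that `g` is constant. Its increment over `s` is an isometry applied to `V s y - W s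
  -- y` with `y = V t x`, which is `o(s)`; no product rule for operator families is needed.
  let g : ℝ → E := fun t => W (-t) (V t x)
  have hg : ∀ t, HasDerivAt g 0 t := by
    intro t
    obtain ⟨y, h1, h2⟩ := h t
    have h3 : HasDerivAt (fun s => V s (V t x) - W s (V t x)) 0 0 := by
      simpa using h1.fun_sub h2
    rw [hasDerivAt_iff_isLittleO_nhds_zero] at h3 ⊢
    refine (h3.norm_left.congr_left fun s => ?_).of_norm_left
    have e1 : g (t + s) = W (-(t + s)) (V s (V t x)) := by
      simp only [g]; rw [add_comm t s, hV]
    have e2 : g t = W (-(t + s)) (W s (V t x)) := by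
      rw [← hW]; simp [g]
    rw [e1, e2, smul_zero, sub_zero, sub_zero, ← map_sub, LinearIsometryEquiv.norm_map,
      zero_add, group_zero hV, group_zero hW, sub_self, sub_zero]
  have hc : g t = g 0 :=
    is_const_of_deriv_eq_zero (fun t => (hg t).differentiableAt) (fun t => (hg t).deriv) t 0
  have h0 : W (-t) (V t x) = x := by
    have : g 0 = x := by simp [g, group_zero hV, group_zero hW]
    exact hc.trans this
  have := hW t (-t) (V t x)
  rw [add_neg_cancel, group_zero hW, h0] at this
  exact this

/-- A one-parameter group of isometries is strongly continuous if it is so at time zero on a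
total set. -/
theorem group_continuous {V : ℝ → (E ≃ₗᵢ[ℂ] E)} (hV : ∀ s t x, V (s + t) x = V s (V t x))
    {S : Set E} (hS : Dense (Submodule.span ℂ S : Set E))
    (h : ∀ x ∈ S, ContinuousAt (fun t => V t x) 0) (x : E) : Continuous fun t => V t x := by
  have h1 : ∀ x ∈ Submodule.span ℂ S, ContinuousAt (fun t => V t x) 0 := by
    intro x hx
    induction hx using Submodule.span_induction with
    | mem x hx => exact h x hx
    | zero => simpa using continuousAt_const
    | add x y _ _ hx hy => simpa using hx.fun_add hy
    | smul c x _ hx => simpa using hx.fun_const_smul c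
  have h2 : ContinuousAt (fun t => V t x) 0 := by
    rw [Metric.continuousAt_iff']
    intro ε hε
    obtain ⟨y, hy, hxy⟩ := Metric.mem_closure_iff.1 (hS x) (ε / 3) (by positivity)
    filter_upwards [Metric.continuousAt_iff'.1 (h1 y hy) (ε / 3) (by positivity)] with t ht
    have a1 : dist (V t x) (V t y) = dist x y := (V t).dist_map x y
    have a2 : dist (V 0 y) (V 0 x) = dist y x := (V 0).dist_map y x
    have := dist_triangle4 (V t x) (V t y) (V 0 y) (V 0 x)
    rw [a1, a2, dist_comm y x] at this
    linarith
  refine continuous_iff_continuousAt.2 fun t => ?_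
  have h3 : (fun s => V s x) = fun s => V t (V (s - t) x) := by
    funext s; rw [← hV]; simp
  rw [h3]
  refine (V t).continuous.continuousAt.comp ?_
  refine ContinuousAt.comp (g := fun s => V s x) (f := fun s => s - t) ?_ (by fun_prop)
  simpa using h2

end OneParameterGroups

/-! ### Differentiation in `L²` of compactly supported families. -/

section DerivativeInLp

variable {X : Type*} [TopologicalSpace X] [MeasurableSpace X] [OpensMeasurableSpace X]
  [T2Space X] {μ : Measure X} [IsFiniteMeasureOnCompacts μ]
variable {E : Type*} [NormedAddCommGroup E] [NormedSpace ℝ E]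

/-- A family of functions that are supported in a common compact set and have a continuous time
derivative is differentiable in `L²`. -/
theorem hasDerivAt_Lp_of_compact {u : ℝ → Lp E 2 μ} {w : Lp E 2 μ} {F F' : ℝ → X → E} {K : Set X}
    (hK : IsCompact K) (hu : ∀ t, u t =ᵐ[μ] F t) (hw : w =ᵐ[μ] F' 0)
    (hsupp : ∀ t ∈ Set.Icc (-1 : ℝ) 1, ∀ x ∉ K, F t x = 0)
    (hd : ∀ t x, HasDerivAt (fun s => F s x) (F' t x) t)
    (hc : Continuous fun p : ℝ × X => F' p.1 p.2) : HasDerivAt u w 0 := by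
  rw [hasDerivAt_iff_isLittleO_nhds_zero, Asymptotics.isLittleO_iff]
  intro c hc0
  have hμK : μ K ≠ ⊤ := hK.measure_lt_top.ne
  set M : ℝ := μ.real K ^ (1 / 2 : ℝ) with hM
  have hM0 : 0 ≤ M := by positivity
  -- Chosen so that `ε * M ≤ c`, also when `K` is a null set and `M = 0`.
  set ε : ℝ := c / (M + 1) with hε
  have hε0 : 0 < ε := by positivity
  -- Compactness of `K` makes the continuity of the time derivative uniform in `x`.
  have hev : ∀ᶠ s in nhds (0 : ℝ), ∀ x ∈ K, ‖F' s x - F' 0 x‖ < ε := by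
    refine hK.eventually_forall_of_forall_eventually fun x _ => ?_
    have h1 : Continuous fun p : ℝ × X => ‖F' p.1 p.2 - F' 0 p.2‖ :=
      (hc.sub (hc.comp (by fun_prop : Continuous fun p : ℝ × X => ((0 : ℝ), p.2)))).norm
    exact h1.continuousAt.eventually (gt_mem_nhds (by simpa using hε0))
  obtain ⟨δ, hδ, hball⟩ := Metric.eventually_nhds_iff_ball.1 hev
  filter_upwards [Metric.ball_mem_nhds (0 : ℝ) (lt_min hδ one_pos)] with t ht
  have ht1 : |t| < δ := by simpa using (Metric.mem_ball.1 ht).trans_le (min_le_left _ _)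
  have ht2 : |t| < 1 := by simpa using (Metric.mem_ball.1 ht).trans_le (min_le_right _ _)
  have hout : ∀ x ∉ K, F' 0 x = 0 := by
    intro x hx
    have h1 : HasDerivAt (fun s => F s x) 0 0 := by
      refine (hasDerivAt_const (0 : ℝ) (0 : E)).congr_of_eventuallyEq ?_
      filter_upwards [Icc_mem_nhds (by norm_num : (-1 : ℝ) < 0) one_pos] with s hs
      exact hsupp s hs x hx
    exact (hd 0 x).unique h1
  have hpt : ∀ x, ‖F t x - F 0 x - t • F' 0 x‖ ≤ ‖K.indicator (fun _ => ε * |t|) x‖ := by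
    intro x
    by_cases hx : x ∈ K
    · rw [Set.indicator_of_mem hx, Real.norm_of_nonneg (by positivity)]
      -- Mean value inequality for `F s x - s • F' 0 x`, whose derivative in `s` is smaller than
      -- `ε`.
      have hconv := (convex_ball (0 : ℝ) δ).norm_image_sub_le_of_norm_hasDerivWithin_le
        (f := fun s => F s x - s • F' 0 x) (f' := fun s => F' s x - F' 0 x) (C := ε)
        (x := 0) (y := t)
        (fun s _ => by
          simpa using ((hd s x).fun_sub ((hasDerivAt_id s).smul_const (F' 0 x))).hasDerivWithinAt)
        (fun s hs => (hball s hs x hx).le) (Metric.mem_ball_self hδ) (by simpa using ht1)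
      simpa [sub_right_comm] using hconv
    · have h0 : (0 : ℝ) ∈ Set.Icc (-1 : ℝ) 1 := by norm_num
      have h1 : t ∈ Set.Icc (-1 : ℝ) 1 := abs_le.1 ht2.le
      simp [hsupp t h1 x hx, hsupp 0 h0 x hx, hout x hx]
  have hnorm : ‖u (0 + t) - u 0 - t • w‖ ≤
      ‖indicatorConstLp 2 hK.measurableSet hμK (ε * |t|)‖ := by
    refine Lp.norm_le_norm_of_ae_le ?_
    filter_upwards [hu t, hu 0, hw, Lp.coeFn_sub (u (0 + t) - u 0) (t • w),
      Lp.coeFn_sub (u (0 + t)) (u 0), Lp.coeFn_smul t w,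
      indicatorConstLp_coeFn (p := 2) (hs := hK.measurableSet) (hμs := hμK) (c := ε * |t|)]
      with x h1 h2 h3 h4 h5 h6 h7
    rw [h7, h4, Pi.sub_apply, h5, Pi.sub_apply, h6, Pi.smul_apply, h2, h3, zero_add, h1]
    exact hpt x
  refine hnorm.trans ?_
  rw [norm_indicatorConstLp (by norm_num) (by norm_num), Real.norm_of_nonneg (by positivity),
    Real.norm_eq_abs]
  have : ε * M ≤ c := by
    rw [hε, div_mul_eq_mul_div, div_le_iff₀ (by positivity)]
    nlinarith
  calc ε * |t| * μ.real K ^ (1 / ENNReal.toReal 2) = ε * M * |t| := by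
        rw [hM]; norm_num; ring
    _ ≤ c * |t| := by gcongr

end DerivativeInLp

/-! ### The shear flow and its phase cocycle. -/

section Flow

/-- The flow `(q, b) ↦ (q - β b t, b)` of the coupling `P ⊗ B`. -/
def flow (β t : ℝ) (x : ℝ × ℝ) : ℝ × ℝ := (x.1 - β * x.2 * t, x.2)

/-- The phase that the component of the eigenvalue `ak` acquires along the flow. -/
noncomputable def flowPhase (ħ α β ak t : ℝ) (x : ℝ × ℝ) : ℝ :=
  -(α * ak / ħ) * (x.1 * t - β * x.2 * t ^ 2 / 2)

theorem flow_zero (β : ℝ) (x : ℝ × ℝ) : flow β 0 x = x := by simp [flow]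

theorem flow_flow (β s t : ℝ) (x : ℝ × ℝ) : flow β t (flow β s x) = flow β (s + t) x := by
  simp only [flow, Prod.mk.injEq, and_true]; ring

theorem flowPhase_add (ħ α β ak s t : ℝ) (x : ℝ × ℝ) :
    flowPhase ħ α β ak s x + flowPhase ħ α β ak t (flow β s x) =
      flowPhase ħ α β ak (s + t) x := by
  simp only [flow, flowPhase]; ring

/-- For each fixed `b` the flow translates `q`, which preserves Lebesgue measure; nothing is asked
of `μ` beyond s-finiteness. The swap puts the base variable first, as skew products require. -/
theorem measurePreserving_flow (μ : Measure ℝ) [SFinite μ] (β t : ℝ) :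
    MeasurePreserving (flow β t) ((volume : Measure ℝ).prod μ) ((volume : Measure ℝ).prod μ) := by
  have h1 : MeasurePreserving (fun p : ℝ × ℝ => (p.1, p.2 - β * p.1 * t)) (μ.prod volume)
      (μ.prod volume) :=
    (MeasurePreserving.id μ).skew_product (g := fun b q => q - β * b * t) (by fun_prop)
      (Filter.Eventually.of_forall fun b =>
        (measurePreserving_sub_right (volume : Measure ℝ) (β * b * t)).map_eq)
  exact Measure.measurePreserving_swap.comp (h1.comp Measure.measurePreserving_swap)

end Flow

/-! ### The explicit unitary group. -/

section Evolution

variable {H : Type*} [NormedAddCommGroup H] [InnerProductSpace ℂ H] {ι : Type*} [Fintype ι]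
variable (φ : OrthonormalBasis ι ℂ H) (a : ι → ℝ) (ħ α β : ℝ)

/-- The solution at time `t` of the Schrödinger equation with initial value `u`. -/
noncomputable def evolveFun (t : ℝ) (u : ℝ × ℝ → H) (x : ℝ × ℝ) : H :=
  ∑ k, (Complex.exp (flowPhase ħ α β (a k) t x * Complex.I) * inner ℂ (φ k) (u (flow β t x))) • φ k

theorem inner_evolveFun (t : ℝ) (u : ℝ × ℝ → H) (x : ℝ × ℝ) (k : ι) :
    inner ℂ (φ k) (evolveFun φ a ħ α β t u x) =
      Complex.exp (flowPhase ħ α β (a k) t x * Complex.I) * inner ℂ (φ k) (u (flow β t x)) := by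
  rw [evolveFun, φ.orthonormal.inner_right_fintype]

theorem norm_evolveFun (t : ℝ) (u : ℝ × ℝ → H) (x : ℝ × ℝ) :
    ‖evolveFun φ a ħ α β t u x‖ = ‖u (flow β t x)‖ := by
  rw [← sq_eq_sq₀ (norm_nonneg _) (norm_nonneg _), ← φ.sum_sq_norm_inner_right,
    ← φ.sum_sq_norm_inner_right]
  simp only [inner_evolveFun, norm_mul, Complex.norm_exp_ofReal_mul_I, one_mul]

/-- The phase is the integral of `-αa_k q/ħ` along the backward characteristic, so it is a cocycle
over the flow. -/
theorem evolveFun_add_time (s t : ℝ) (u : ℝ × ℝ → H) :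
    evolveFun φ a ħ α β (s + t) u = evolveFun φ a ħ α β s (evolveFun φ a ħ α β t u) := by
  funext x
  simp only [evolveFun]
  refine Finset.sum_congr rfl fun k _ => ?_
  congr 1
  change _ = _ * inner ℂ (φ k) (evolveFun φ a ħ α β t u (flow β s x))
  rw [inner_evolveFun, flow_flow, ← flowPhase_add, ← mul_assoc, ← Complex.exp_add]
  push_cast
  ring_nf

theorem evolveFun_zero (u : ℝ × ℝ → H) : evolveFun φ a ħ α β 0 u = u := by
  funext x
  simp [evolveFun, flowPhase, flow_zero, φ.sum_repr' (u x)]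

variable {μ : Measure ℝ} [SFinite μ]

theorem evolveFun_congr (t : ℝ) {u v : ℝ × ℝ → H} (h : u =ᵐ[(volume : Measure ℝ).prod μ] v) :
    evolveFun φ a ħ α β t u =ᵐ[(volume : Measure ℝ).prod μ] evolveFun φ a ħ α β t v := by
  filter_upwards [(measurePreserving_flow μ β t).quasiMeasurePreserving.ae_eq_comp h] with x hx
  simp only [Function.comp_apply] at hx
  simp [evolveFun, hx]

theorem continuous_flowPhase (ak t : ℝ) : Continuous (flowPhase ħ α β ak t) := by
  unfold flowPhase; fun_prop

theorem memLp_evolveFun (t : ℝ) {u : ℝ × ℝ → H} (hu : MemLp u 2 ((volume : Measure ℝ).prod μ)) :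
    MemLp (evolveFun φ a ħ α β t u) 2 ((volume : Measure ℝ).prod μ) := by
  have h1 := hu.comp_measurePreserving (measurePreserving_flow μ β t)
  refine h1.of_le ?_ (Filter.Eventually.of_forall fun x => (norm_evolveFun φ a ħ α β t u x).le)
  refine Finset.aestronglyMeasurable_fun_sum _ fun k _ => ?_
  refine AEStronglyMeasurable.smul_const (AEStronglyMeasurable.mul ?_ ?_) _
  · refine Continuous.aestronglyMeasurable ?_
    have := continuous_flowPhase ħ α β (a k) t
    fun_prop
  · exact h1.1.const_inner

/-- The evolution as a linear isometry. -/
noncomputable def evolveIsometry (μ : Measure ℝ) [SFinite μ] (t : ℝ) : Total H μ →ₗᵢ[ℂ] Total H μ where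
  toFun u := (memLp_evolveFun φ a ħ α β t (Lp.memLp u)).toLp _
  map_add' u v := by
    rw [← MemLp.toLp_add, MemLp.toLp_eq_toLp_iff]
    refine (evolveFun_congr φ a ħ α β t (Lp.coeFn_add u v)).trans
      (Filter.Eventually.of_forall fun x => ?_)
    simp [evolveFun, mul_add, add_smul, Finset.sum_add_distrib]
  map_smul' c u := by
    rw [RingHom.id_apply, ← MemLp.toLp_const_smul, MemLp.toLp_eq_toLp_iff]
    refine (evolveFun_congr φ a ħ α β t (Lp.coeFn_smul c u)).trans
      (Filter.Eventually.of_forall fun x => ?_)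
    simp [evolveFun, Finset.smul_sum, smul_smul, mul_left_comm]
  norm_map' u := by
    change ‖(memLp_evolveFun φ a ħ α β t (Lp.memLp u)).toLp _‖ = ‖u‖
    rw [Lp.norm_toLp, Lp.norm_def]
    congr 1
    rw [eLpNorm_congr_norm_ae (Filter.Eventually.of_forall
      fun x => norm_evolveFun φ a ħ α β t u x)]
    exact eLpNorm_comp_measurePreserving (Lp.aestronglyMeasurable u) (measurePreserving_flow μ β t)

theorem coeFn_evolveIsometry (t : ℝ) (u : Total H μ) :
    evolveIsometry φ a ħ α β μ t u =ᵐ[(volume : Measure ℝ).prod μ] evolveFun φ a ħ α β t u :=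
  MemLp.coeFn_toLp (memLp_evolveFun φ a ħ α β t (Lp.memLp u))

theorem evolveIsometry_add (s t : ℝ) (u : Total H μ) :
    evolveIsometry φ a ħ α β μ (s + t) u =
      evolveIsometry φ a ħ α β μ s (evolveIsometry φ a ħ α β μ t u) := by
  refine Lp.ext ?_
  refine (coeFn_evolveIsometry φ a ħ α β (s + t) u).trans ?_
  refine Filter.EventuallyEq.trans ?_ (coeFn_evolveIsometry φ a ħ α β s _).symm
  refine Filter.EventuallyEq.trans ?_
    (evolveFun_congr φ a ħ α β s (coeFn_evolveIsometry φ a ħ α β t u)).symm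
  rw [evolveFun_add_time]

theorem evolveIsometry_zero (u : Total H μ) : evolveIsometry φ a ħ α β μ 0 u = u := by
  refine Lp.ext ((coeFn_evolveIsometry φ a ħ α β 0 u).trans ?_)
  rw [evolveFun_zero]

/-- The evolution as a unitary operator. -/
noncomputable def evolve (μ : Measure ℝ) [SFinite μ] (t : ℝ) : Total H μ ≃ₗᵢ[ℂ] Total H μ where
  toLinearEquiv := LinearEquiv.ofLinearMap (evolveIsometry φ a ħ α β μ t).toLinearMap
    (evolveIsometry φ a ħ α β μ (-t)).toLinearMap
    (by
      ext1 u
      change evolveIsometry φ a ħ α β μ t (evolveIsometry φ a ħ α β μ (-t) u) = u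
      rw [← evolveIsometry_add, add_neg_cancel, evolveIsometry_zero])
    (by
      ext1 u
      change evolveIsometry φ a ħ α β μ (-t) (evolveIsometry φ a ħ α β μ t u) = u
      rw [← evolveIsometry_add, neg_add_cancel, evolveIsometry_zero])
  norm_map' := (evolveIsometry φ a ħ α β μ t).norm_map

theorem coeFn_evolve (t : ℝ) (u : Total H μ) :
    evolve φ a ħ α β μ t u =ᵐ[(volume : Measure ℝ).prod μ] evolveFun φ a ħ α β t u :=
  coeFn_evolveIsometry φ a ħ α β t u

theorem evolve_add (s t : ℝ) (u : Total H μ) :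
    evolve φ a ħ α β μ (s + t) u = evolve φ a ħ α β μ s (evolve φ a ħ α β μ t u) :=
  evolveIsometry_add φ a ħ α β s t u

end Evolution

/-! ### The invariant core: generator, density and uniqueness. -/

section Core

variable {H : Type*} [NormedAddCommGroup H] [InnerProductSpace ℂ H] {ι : Type*} [Fintype ι]
variable (φ : OrthonormalBasis ι ℂ H) {a : ι → ℝ} {A : H →ₗ[ℂ] H}
variable {μ : Measure ℝ} [IsLocallyFiniteMeasure μ] {ħ : ℝ} (α β : ℝ)

theorem apply_eq_sum_of_eigenbasis (hA : ∀ k, A (φ k) = (a k : ℂ) • φ k) (v : H) :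
    A v = ∑ k, ((a k : ℂ) * inner ℂ (φ k) v) • φ k := by
  conv_lhs => rw [← φ.sum_repr' v]
  rw [map_sum]
  refine Finset.sum_congr rfl fun k _ => ?_
  rw [map_smul, hA, smul_smul, mul_comm]

theorem deriv_partial_fst {f : ℝ × ℝ → ℂ} (hf : ContDiff ℝ ∞ f) (x : ℝ × ℝ) :
    deriv (fun q : ℝ => f (q, x.2)) x.1 = fderiv ℝ f x (1, 0) := by
  have h1 : HasDerivAt (fun q : ℝ => ((q, x.2) : ℝ × ℝ)) (1, 0) x.1 :=
    (hasDerivAt_id x.1).prodMk (hasDerivAt_const x.1 x.2)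
  exact ((hf.differentiable (by simp) x).hasFDerivAt.comp_hasDerivAt x.1 h1).deriv

/-- The image is continuous with compact support, hence in `L²` as `μ` is locally finite. So the
generator condition of an evolution really applies to every such vector. -/
theorem exists_measHamiltonian (ħ : ℝ) (A : H →ₗ[ℂ] H) {f : ℝ × ℝ → ℂ} (hf : ContDiff ℝ ∞ f)
    (hfc : HasCompactSupport f) (v : H) {u : Total H μ}
    (hu : u =ᵐ[(volume : Measure ℝ).prod μ] fun x => f x • v) :
    ∃ X, MeasHamiltonian ħ α β A u X := by
  have hc : Continuous fun x : ℝ × ℝ => ((α : ℂ) * ((x.1 : ℂ) * f x)) • A v +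
      ((β : ℂ) * ((x.2 : ℂ) * (-Complex.I * ħ * fderiv ℝ f x (1, 0)))) • v := by
    have h1 := hf.continuous
    have h2 : Continuous fun x => fderiv ℝ f x (1, 0) :=
      (hf.continuous_fderiv (by simp)).clm_apply continuous_const
    fun_prop
  have hs : HasCompactSupport fun x : ℝ × ℝ => ((α : ℂ) * ((x.1 : ℂ) * f x)) • A v +
      ((β : ℂ) * ((x.2 : ℂ) * (-Complex.I * ħ * fderiv ℝ f x (1, 0)))) • v := by
    refine hfc.mono' fun x hx => ?_
    by_contra hn
    have h1 : f x = 0 := image_eq_zero_of_notMem_tsupport hn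
    have h2 : fderiv ℝ f x = 0 := by
      by_contra h
      exact hn (support_fderiv_subset ℝ h)
    exact hx (by simp [h1, h2])
  refine ⟨(hc.memLp_of_hasCompactSupport (p := 2) (μ := (volume : Measure ℝ).prod μ) hs).toLp _,
    f, v, hf, hfc, hu, ?_⟩
  refine (MemLp.coeFn_toLp _).trans (Filter.Eventually.of_forall fun x => ?_)
  simp only [deriv_partial_fst hf]

/-- At time zero the phase contributes `-iαa_k q/ħ` and the transport `-βb ∂_q`; together they are
`-i/ħ` times the Hamiltonian. -/
theorem hasDerivAt_evolve (hħ : ħ ≠ 0) (hA : ∀ k, A (φ k) = (a k : ℂ) • φ k) {u X : Total H μ}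
    (hX : MeasHamiltonian ħ α β A u X) :
    HasDerivAt (fun t => evolve φ a ħ α β μ t u) ((-Complex.I / (ħ : ℂ)) • X) 0 := by
  obtain ⟨f, v, hf, hfc, hu, hX⟩ := hX
  have hfd : Continuous (fderiv ℝ f) := hf.continuous_fderiv (by simp)
  have hf0 := hf.continuous
  let F : ℝ → ℝ × ℝ → H := fun t x =>
    ∑ k, (Complex.exp (flowPhase ħ α β (a k) t x * Complex.I) * f (flow β t x) *
      inner ℂ (φ k) v) • φ k
  let F' : ℝ → ℝ × ℝ → H := fun t x =>
    ∑ k, ((Complex.exp (flowPhase ħ α β (a k) t x * Complex.I) *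
        ((-(α * a k / ħ) * (x.1 - β * x.2 * t) : ℝ) * Complex.I) * f (flow β t x) +
      Complex.exp (flowPhase ħ α β (a k) t x * Complex.I) *
        fderiv ℝ f (flow β t x) (-(β * x.2), 0)) * inner ℂ (φ k) v) • φ k
  have hKc : Continuous fun p : ℝ × (ℝ × ℝ) => flow β (-p.1) p.2 := by
    unfold flow; fun_prop
  -- The compact set is what the support of `f` sweeps out under the inverse flow for `|t| ≤ 1`.
  refine hasDerivAt_Lp_of_compact (F := F) (F' := F')
    ((isCompact_Icc (a := (-1 : ℝ)) (b := 1)).prod hfc |>.image hKc) ?_ ?_ ?_ ?_ ?_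
  · intro t
    refine (coeFn_evolve φ a ħ α β t u).trans ((evolveFun_congr φ a ħ α β t hu).trans
      (Filter.Eventually.of_forall fun x => ?_))
    simp [F, evolveFun, mul_assoc]
  · refine (Lp.coeFn_smul _ _).trans ?_
    filter_upwards [hX] with x hx
    rw [Pi.smul_apply, hx, deriv_partial_fst hf, apply_eq_sum_of_eigenbasis φ hA]
    conv_lhs => rw [← φ.sum_repr' v]
    have h1 : fderiv ℝ f x (-(β * x.2), 0) = -(β * x.2 : ℝ) * fderiv ℝ f x (1, 0) := by
      have : ((-(β * x.2), 0) : ℝ × ℝ) = (-(β * x.2)) • (1, 0) := by simp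
      rw [this, map_smul, Complex.real_smul, Complex.ofReal_neg]
    have hħ' : (ħ : ℂ) ≠ 0 := by exact_mod_cast hħ
    simp only [F', flow_zero, h1, Finset.smul_sum, smul_smul, ← Finset.sum_add_distrib,
      ← add_smul]
    refine Finset.sum_congr rfl fun k _ => ?_
    have hi : inner ℂ (φ k) (∑ i, inner ℂ (φ i) v • φ i) = inner ℂ (φ k) v := by
      rw [φ.sum_repr']
    have h2 : flowPhase ħ α β (a k) 0 x = 0 := by simp [flowPhase]
    rw [hi, h2]
    congr 1
    push_cast
    simp only [mul_zero, sub_zero, zero_mul, Complex.exp_zero, one_mul]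
    field_simp
    linear_combination (β * x.2 * inner ℂ (φ k) v * fderiv ℝ f x (1, 0) * ħ : ℂ) * Complex.I_sq
  · intro t ht x hx
    have h0 : f (flow β t x) = 0 := by
      refine image_eq_zero_of_notMem_tsupport fun h => hx ⟨(t, flow β t x), ⟨ht, h⟩, ?_⟩
      simp [flow_flow, flow_zero]
    simp [F, h0]
  · intro t x
    refine HasDerivAt.fun_sum fun k _ => ?_
    refine HasDerivAt.smul_const (HasDerivAt.mul_const (HasDerivAt.mul ?_ ?_) _) _
    · have h1 : HasDerivAt (fun s => flowPhase ħ α β (a k) s x)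
          (-(α * a k / ħ) * (x.1 - β * x.2 * t)) t := by
        have := (((hasDerivAt_id t).const_mul x.1).sub
          ((((hasDerivAt_id t).pow 2).const_mul (β * x.2)).div_const 2)).const_mul (-(α * a k / ħ))
        refine this.congr_deriv ?_
        simp only [id, Nat.add_one_sub_one, pow_one, Nat.cast_ofNat]
        ring
      exact (h1.ofReal_comp.mul_const Complex.I).cexp
    · have h1 : HasDerivAt (fun s => flow β s x) (-(β * x.2), 0) t := by
        refine HasDerivAt.prodMk ?_ (hasDerivAt_const t x.2)
        simpa using ((hasDerivAt_id t).const_mul (β * x.2)).const_sub x.1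
      exact (hf.differentiable (by simp) _).hasFDerivAt.comp_hasDerivAt t h1
  · have h1 : Continuous fun p : ℝ × (ℝ × ℝ) => flow β p.1 p.2 := by
      unfold flow; fun_prop
    have h2 : ∀ k, Continuous fun p : ℝ × (ℝ × ℝ) => flowPhase ħ α β (a k) p.1 p.2 := by
      intro k; unfold flowPhase; fun_prop
    have h3 : Continuous fun p : ℝ × (ℝ × ℝ) =>
        fderiv ℝ f (flow β p.1 p.2) (-(β * p.2.2), 0) :=
      (hfd.comp h1).clm_apply (by fun_prop)
    have h4 := hf0.comp h1
    refine continuous_finsetSum _ fun k _ => ?_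
    have := h2 k
    simp only [Function.comp_def] at h4
    fun_prop

/-- The products of a test function and an eigenvector. -/
def eigenCore (μ : Measure ℝ) : Set (Total H μ) :=
  {u | ∃ (f : ℝ × ℝ → ℂ) (k : ι), ContDiff ℝ ∞ f ∧ HasCompactSupport f ∧
    u =ᵐ[(volume : Measure ℝ).prod μ] fun x => f x • φ k}

/-- An eigenvector only acquires a scalar phase, so products stay products; a general vector of `H`
would evolve into a sum of products. -/
theorem evolve_mem_eigenCore (a : ι → ℝ) (ħ : ℝ) {u : Total H μ} (hu : u ∈ eigenCore φ μ) (t : ℝ) :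
    evolve φ a ħ α β μ t u ∈ eigenCore φ μ := by
  classical
  obtain ⟨f, k, hf, hfc, hu⟩ := hu
  have h1 : ContDiff ℝ ∞ (flow β t) := by unfold flow; fun_prop
  have h2 : ContDiff ℝ ∞ (flowPhase ħ α β (a k) t) := by unfold flowPhase; fun_prop
  refine ⟨fun x => Complex.exp (flowPhase ħ α β (a k) t x * Complex.I) * f (flow β t x), k,
    ?_, ?_, ?_⟩
  · refine ContDiff.mul ?_ (hf.comp h1)
    exact Complex.contDiff_exp.comp ((Complex.ofRealCLM.contDiff.comp h2).mul contDiff_const)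
  · have h3 : HasCompactSupport (f ∘ flow β t) := by
      refine HasCompactSupport.intro (hfc.isCompact.image
        (f := flow β (-t)) (by unfold flow; fun_prop)) fun x hx => ?_
      change f (flow β t x) = 0
      refine image_eq_zero_of_notMem_tsupport fun h => hx ⟨flow β t x, h, ?_⟩
      simp [flow_flow, flow_zero]
    exact h3.mul_left
  · refine (coeFn_evolve φ a ħ α β t u).trans ((evolveFun_congr φ a ħ α β t hu).trans
      (Filter.Eventually.of_forall fun x => ?_))
    simp [evolveFun, φ.inner_eq_ite]

/-- If `u` is orthogonal to the core, each component `⟨φ_k, u⟩` integrates to zero against all test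
functions and vanishes almost everywhere. -/
theorem dense_span_eigenCore : Dense (Submodule.span ℂ (eigenCore φ μ) : Set (Total H μ)) := by
  have : FiniteDimensional ℂ H := φ.toBasis.finiteDimensional_of_finite
  have : CompleteSpace H := FiniteDimensional.complete ℂ H
  rw [Submodule.dense_iff_topologicalClosure_eq_top, Submodule.topologicalClosure_eq_top_iff,
    Submodule.eq_bot_iff]
  intro u hu
  have key : ∀ k, ∀ᵐ x ∂((volume : Measure ℝ).prod μ), inner ℂ (φ k) (u x) = 0 := by
    intro k
    refine ae_eq_zero_of_integral_contDiff_smul_eq_zero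
      (((Lp.memLp u).const_inner (φ k)).locallyIntegrable one_le_two) fun g hg hgc => ?_
    have hgC : ContDiff ℝ ∞ (fun x => (g x : ℂ)) := Complex.ofRealCLM.contDiff.comp hg
    have hgCc : HasCompactSupport (fun x => (g x : ℂ)) := hgc.comp_left Complex.ofReal_zero
    have hm : MemLp (fun x => (g x : ℂ) • φ k) 2 ((volume : Measure ℝ).prod μ) :=
      (hgC.continuous.smul continuous_const).memLp_of_hasCompactSupport hgCc.smul_right
    have h0 := Submodule.inner_right_of_mem_orthogonal
      (Submodule.subset_span (s := eigenCore φ μ) ⟨_, k, hgC, hgCc, hm.coeFn_toLp⟩) hu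
    rw [L2.inner_def] at h0
    rw [← h0]
    refine integral_congr_ae ?_
    filter_upwards [hm.coeFn_toLp] with x hx
    rw [hx, inner_smul_left, Complex.conj_ofReal, Complex.real_smul]
  refine (Lp.eq_zero_iff_ae_eq_zero).2 ?_
  filter_upwards [ae_all_iff.2 key] with x hx
  rw [← φ.sum_repr' (u x)]
  simp [hx]

theorem isEvolution_evolve (hħ : ħ ≠ 0) (hA : ∀ k, A (φ k) = (a k : ℂ) • φ k) :
    IsEvolution ħ α β A (evolve φ a ħ α β μ) where
  add := evolve_add φ a ħ α β
  continuous := group_continuous (evolve_add φ a ħ α β) (dense_span_eigenCore φ) (by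
    rintro u ⟨f, k, hf, hfc, hu⟩
    obtain ⟨X, hX⟩ := exists_measHamiltonian α β ħ A hf hfc (φ k) hu
    exact (hasDerivAt_evolve φ α β hħ hA hX).continuousAt)
  deriv _ _ := hasDerivAt_evolve φ α β hħ hA

/-- The evolution is unique: the core is invariant under it. -/
theorem IsEvolution.eq_evolve (hħ : ħ ≠ 0) (hA : ∀ k, A (φ k) = (a k : ℂ) • φ k)
    {V : ℝ → (Total H μ ≃ₗᵢ[ℂ] Total H μ)} (hV : IsEvolution ħ α β A V) :
    V = evolve φ a ħ α β μ := by
  funext t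
  have h : ∀ u ∈ eigenCore φ μ, V t u = evolve φ a ħ α β μ t u := by
    intro u hu
    refine (group_apply_eq_of_hasDerivAt (evolve_add φ a ħ α β) hV.add (fun s => ?_) t).symm
    obtain ⟨f, k, hf, hfc, hs⟩ := evolve_mem_eigenCore φ α β a ħ hu s
    obtain ⟨X, hX⟩ := exists_measHamiltonian α β ħ A hf hfc (φ k) hs
    exact ⟨_, hasDerivAt_evolve φ α β hħ hA hX, hV.deriv _ _ hX⟩
  have := ContinuousLinearMap.ext_on (dense_span_eigenCore φ)
    (f := ((V t).toContinuousLinearEquiv : Total H μ →L[ℂ] Total H μ))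
    (g := ((evolve φ a ħ α β μ t).toContinuousLinearEquiv : Total H μ →L[ℂ] Total H μ)) h
  ext1 u
  exact congrArg (fun T => T u) this

end Core

/-! ### Pointer phases `exp(isB)`. -/

section Phase

variable {μ : Measure ℝ}

theorem coeFn_phase (s : ℝ) (Φ : Pointer μ) :
    phase s Φ =ᵐ[μ] fun b => Complex.exp (Complex.I * s * b) * Φ b :=
  (memLp_phase s Φ).coeFn_toLp

theorem norm_exp_phase (s b : ℝ) : ‖Complex.exp (Complex.I * s * b)‖ = 1 := by
  have h : Complex.I * s * b = ((s * b : ℝ) : ℂ) * Complex.I := by push_cast; ring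
  rw [h, Complex.norm_exp_ofReal_mul_I]

theorem norm_phase (s : ℝ) (Φ : Pointer μ) : ‖phase s Φ‖ = ‖Φ‖ := by
  rw [phase, Lp.norm_toLp, Lp.norm_def]
  congr 1
  refine eLpNorm_congr_norm_ae (Filter.Eventually.of_forall fun b => ?_)
  rw [norm_mul, norm_exp_phase, one_mul]

/-- Dominated convergence: the squared distance is an integral bounded by that of `4|Φ|²`. -/
theorem continuous_phase (Φ : Pointer μ) : Continuous fun s => phase s Φ := by
  have hsq : ∀ s t : ℝ, ‖phase s Φ - phase t Φ‖ ^ 2 =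
      ∫ b, ‖Complex.exp (Complex.I * s * b) - Complex.exp (Complex.I * t * b)‖ ^ 2 *
        ‖Φ b‖ ^ 2 ∂μ := by
    intro s t
    have h1 : ((‖phase s Φ - phase t Φ‖ ^ 2 : ℝ) : ℂ) = ((∫ b,
        ‖Complex.exp (Complex.I * s * b) - Complex.exp (Complex.I * t * b)‖ ^ 2 *
          ‖Φ b‖ ^ 2 ∂μ : ℝ) : ℂ) := by
      rw [← integral_complex_ofReal, Complex.ofReal_pow]
      refine (inner_self_eq_norm_sq_to_K (𝕜 := ℂ) (phase s Φ - phase t Φ)).symm.trans ?_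
      rw [L2.inner_def]
      refine integral_congr_ae ?_
      filter_upwards [Lp.coeFn_sub (phase s Φ) (phase t Φ), coeFn_phase s Φ, coeFn_phase t Φ]
        with b h1 h2 h3
      rw [h1, Pi.sub_apply, h2, h3, ← sub_mul, inner_self_eq_norm_sq_to_K, norm_mul]
      simp [mul_pow]
    exact_mod_cast h1
  refine continuous_iff_continuousAt.2 fun t => ?_
  rw [ContinuousAt, tendsto_iff_norm_sub_tendsto_zero]
  have hc : Continuous fun s => ‖phase s Φ - phase t Φ‖ ^ 2 := by
    simp only [hsq]
    have hi := (memLp_two_iff_integrable_sq_norm (Lp.memLp Φ).1).1 (Lp.memLp Φ)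
    refine continuous_of_dominated (bound := fun b => 4 * ‖Φ b‖ ^ 2) (fun s => ?_) (fun s => ?_)
      (hi.const_mul 4) (Filter.Eventually.of_forall fun b => by fun_prop)
    · exact (Continuous.aestronglyMeasurable (by fun_prop)).mul hi.1
    · refine Filter.Eventually.of_forall fun b => ?_
      rw [Real.norm_of_nonneg (by positivity)]
      have h2 : ‖Complex.exp (Complex.I * s * b) - Complex.exp (Complex.I * t * b)‖ ≤ 2 := by
        refine (norm_sub_le _ _).trans ?_
        rw [norm_exp_phase, norm_exp_phase]; norm_num
      have h3 := pow_le_pow_left₀ (norm_nonneg _) h2 2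
      gcongr
      linarith
  have h0 := (hc.tendsto t).sqrt
  simpa using h0

end Phase

/-! ### Overlaps with phase-shifted pointer states. -/

section Overlap

variable {H : Type*} [NormedAddCommGroup H] [InnerProductSpace ℂ H] {μ : Measure ℝ}

theorem coeFn_contract (v : H) (u : SysPointer H μ) :
    contract μ v u =ᵐ[μ] fun b => inner ℂ v (u b) :=
  ContinuousLinearMap.coeFn_compLpL (innerSL ℂ v) u

theorem coeFn_embed (v : H) (g : Pointer μ) : embed μ v g =ᵐ[μ] fun b => g b • v :=
  ContinuousLinearMap.coeFn_compLpL (ContinuousLinearMap.toSpanSingleton ℂ v) g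

theorem inner_embed_right (v : H) (u : SysPointer H μ) (g : Pointer μ) :
    inner ℂ u (embed μ v g) = inner ℂ (contract μ v u) g := by
  rw [L2.inner_def, L2.inner_def]
  refine integral_congr_ae ?_
  filter_upwards [coeFn_contract v u, coeFn_embed v g] with b h1 h2
  rw [h1, h2, inner_smul_right, RCLike.inner_apply, inner_conj_symm]

/-- The overlap of `⟨v|u⟩` with `exp(i s B) Φ`. -/
noncomputable def overlap (v : H) (u : SysPointer H μ) (Φ : Pointer μ) (s : ℝ) : ℂ :=
  inner ℂ (contract μ v u) (phase s Φ)

theorem continuous_overlap (v : H) (u : SysPointer H μ) (Φ : Pointer μ) :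
    Continuous (overlap v u Φ) :=
  continuous_const.inner (continuous_phase Φ)

theorem norm_overlap_le (v : H) (u : SysPointer H μ) (Φ : Pointer μ) (s : ℝ) :
    ‖overlap v u Φ s‖ ≤ ‖contract μ v u‖ * ‖Φ‖ :=
  (norm_inner_le_norm _ _).trans_eq (by rw [norm_phase])

theorem overlap_eq_integral (v : H) (u : SysPointer H μ) (Φ : Pointer μ) (s : ℝ) :
    overlap v u Φ s = ∫ b, Complex.exp (Complex.I * s * b) * (inner ℂ (u b) v * Φ b) ∂μ := by
  rw [overlap, L2.inner_def]
  refine integral_congr_ae ?_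
  filter_upwards [coeFn_contract v u, coeFn_phase s Φ] with b h1 h2
  rw [h1, h2, RCLike.inner_apply, inner_conj_symm]
  ring

theorem integrable_inner_mul (v : H) (u : SysPointer H μ) (Φ : Pointer μ) :
    Integrable (fun b => inner ℂ (u b) v * Φ b) μ :=
  ((Lp.memLp u).inner_const v).integrable_mul (Lp.memLp Φ)

end Overlap

/-! ### The probe amplitude of a single eigenvalue. -/

section Component

variable {H : Type*} [NormedAddCommGroup H] [InnerProductSpace ℂ H] {μ : Measure ℝ}
variable {h : ℝ → ℂ}

/-- The momentum amplitude of the probe that belongs to the eigenvalue `ak`, relative to a vector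
`u` of system and pointer. -/
noncomputable def componentAmplitude (h : ℝ → ℂ) (ħ α β ak : ℝ) (v : H) (u : SysPointer H μ)
    (Φ : Pointer μ) (ξ : ℝ) : ℂ :=
  h ξ * overlap v u Φ ((α * ak / 2 - 2 * Real.pi * ħ * ξ) * β / ħ)

variable (ħ α β ak : ℝ) (v : H) (u : SysPointer H μ) (Φ : Pointer μ)

theorem continuous_overlap_comp :
    Continuous fun ξ : ℝ => overlap v u Φ ((α * ak / 2 - 2 * Real.pi * ħ * ξ) * β / ħ) :=
  (continuous_overlap v u Φ).comp (by fun_prop)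

theorem integrable_componentAmplitude (h1 : Integrable h) :
    Integrable (componentAmplitude h ħ α β ak v u Φ) := by
  have := h1.bdd_mul (c := ‖contract μ v u‖ * ‖Φ‖)
    (continuous_overlap_comp ħ α β ak v u Φ).aestronglyMeasurable
    (Filter.Eventually.of_forall fun ξ => norm_overlap_le v u Φ _)
  exact this.congr (Filter.Eventually.of_forall fun ξ => mul_comm _ _)

theorem memLp_componentAmplitude (h2 : MemLp h 2 volume) :
    MemLp (componentAmplitude h ħ α β ak v u Φ) 2 volume := by
  refine h2.of_le_mul (c := ‖contract μ v u‖ * ‖Φ‖)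
    (h2.1.mul (continuous_overlap_comp ħ α β ak v u Φ).aestronglyMeasurable)
    (Filter.Eventually.of_forall fun ξ => ?_)
  rw [componentAmplitude, norm_mul, mul_comm]
  gcongr
  exact norm_overlap_le v u Φ _

variable {ħ} in
-- After exchanging the integrals over `ξ` and `b`, the factor `exp(-2πiξβb)` inside the overlap
-- becomes the translation of `𝓕⁻ h` by `βb`. This links the momentum integral of `ρ_k` to the
-- shear.
theorem fourierInv_componentAmplitude [SFinite μ] (hħ : ħ ≠ 0) (h1 : Integrable h) (q : ℝ) :
    𝓕⁻ (componentAmplitude h ħ α β ak v u Φ) q =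
      ∫ b, Complex.exp (Complex.I * (α * ak * β / (2 * ħ) : ℝ) * b) * (inner ℂ (u b) v * Φ b) *
        𝓕⁻ h (q - β * b) ∂μ := by
  let f : ℝ → ℝ → ℂ := fun ξ b =>
    Complex.exp (((2 * Real.pi * (ξ * q) : ℝ) : ℂ) * Complex.I) *
      Complex.exp (Complex.I * ((α * ak / 2 - 2 * Real.pi * ħ * ξ) * β / ħ : ℝ) * b) *
      (h ξ * (inner ℂ (u b) v * Φ b))
  have hf : Integrable (Function.uncurry f) ((volume : Measure ℝ).prod μ) := by
    refine (h1.mul_prod (integrable_inner_mul v u Φ)).bdd_mul (c := 1)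
      (f := fun p : ℝ × ℝ => Complex.exp (((2 * Real.pi * (p.1 * q) : ℝ) : ℂ) * Complex.I) *
      Complex.exp (Complex.I * ((α * ak / 2 - 2 * Real.pi * ħ * p.1) * β / ħ : ℝ) * p.2))
      (Continuous.aestronglyMeasurable (by fun_prop)) (Filter.Eventually.of_forall fun p => ?_)
    rw [norm_mul, norm_exp_phase, Complex.norm_exp_ofReal_mul_I, one_mul]
  calc 𝓕⁻ (componentAmplitude h ħ α β ak v u Φ) q = ∫ ξ, (∫ b, f ξ b ∂μ) := by
        rw [Real.fourierInv_eq']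
        refine integral_congr_ae (Filter.Eventually.of_forall fun ξ => ?_)
        simp only [componentAmplitude, overlap_eq_integral, RCLike.inner_apply, conj_trivial,
          smul_eq_mul, f]
        rw [← mul_assoc, ← integral_const_mul]
        refine integral_congr_ae (Filter.Eventually.of_forall fun b => ?_)
        simp only [mul_comm q ξ]
        ring
    _ = ∫ b, (∫ ξ, f ξ b) ∂μ := integral_integral_swap hf
    _ = _ := by
        refine integral_congr_ae (Filter.Eventually.of_forall fun b => ?_)
        dsimp only
        rw [Real.fourierInv_eq', ← integral_const_mul]
        refine integral_congr_ae (Filter.Eventually.of_forall fun ξ => ?_)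
        have he : Complex.exp (((2 * Real.pi * (ξ * q) : ℝ) : ℂ) * Complex.I) *
            Complex.exp (Complex.I * ((α * ak / 2 - 2 * Real.pi * ħ * ξ) * β / ħ : ℝ) * b) =
            Complex.exp (Complex.I * (α * ak * β / (2 * ħ) : ℝ) * b) *
              Complex.exp (((2 * Real.pi * ((q - β * b) * ξ) : ℝ) : ℂ) * Complex.I) := by
          have hħ' : (ħ : ℂ) ≠ 0 := by exact_mod_cast hħ
          rw [← Complex.exp_add, ← Complex.exp_add]
          congr 1
          push_cast
          field_simp
          ring
        simp only [f, RCLike.inner_apply, conj_trivial, smul_eq_mul, he]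
        ring

end Component

/-! ### The partial trace over the probe. -/

section ProbeTrace

variable {H : Type*} [NormedAddCommGroup H] [InnerProductSpace ℂ H] {ι : Type*} [Fintype ι]
variable {μ : Measure ℝ} {h : ℝ → ℂ}

theorem coeFn_tensor [SFinite μ] (e : Probe) (u : SysPointer H μ) :
    tensor e u =ᵐ[(volume : Measure ℝ).prod μ] fun x => e x.1 • u x.2 :=
  (memLp_tensor e u).coeFn_toLp

/-- The pairing of a vector of the total space with `u` over system and pointer. -/
theorem inner_tensor_eq [SFinite μ] (e g : Probe) (u : SysPointer H μ) (T : Total H μ) {F : ℝ × ℝ → H}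
    (hF : T =ᵐ[(volume : Measure ℝ).prod μ] F)
    (hg : ∀ᵐ q, g q = ∫ b, inner ℂ (u b) (F (q, b)) ∂μ) :
    inner ℂ (tensor e u) T = inner ℂ e g := by
  have h1 : (fun x => inner ℂ (tensor e u x) (T x)) =ᵐ[(volume : Measure ℝ).prod μ]
      fun x => conj (e x.1) * inner ℂ (u x.2) (F x) := by
    filter_upwards [coeFn_tensor e u, hF] with x hx hx'
    rw [hx, hx', inner_smul_left]
  have hi : Integrable (fun x : ℝ × ℝ => conj (e x.1) * inner ℂ (u x.2) (F x))
      ((volume : Measure ℝ).prod μ) := (L2.integrable_inner (𝕜 := ℂ) (tensor e u) T).congr h1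
  rw [L2.inner_def, L2.inner_def, integral_congr_ae h1, integral_prod _ hi]
  refine integral_congr_ae ?_
  filter_upwards [hg] with q hq
  rw [hq, RCLike.inner_apply, mul_comm, ← integral_const_mul]

variable (φ : OrthonormalBasis ι ℂ H) (a : ι → ℝ) (ħ α β : ℝ) (ψ₀ : H) (Φ : Pointer μ)

/-- The wave function of the final state. -/
noncomputable def finalWave (h : ℝ → ℂ) (x : ℝ × ℝ) : H :=
  ∑ k, (Complex.exp (flowPhase ħ α β (a k) 1 x * Complex.I) *
    (𝓕⁻ h (x.1 - β * x.2) * (Φ x.2 * inner ℂ (φ k) ψ₀))) • φ k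

theorem evolve_tensor_ae_eq [SFinite μ] {Ψ : Probe} (hΨ : Ψ =ᵐ[volume] 𝓕⁻ h) :
    evolve φ a ħ α β μ 1 (tensor Ψ (embed μ ψ₀ Φ)) =ᵐ[(volume : Measure ℝ).prod μ]
      finalWave φ a ħ α β ψ₀ Φ h := by
  have h1 : tensor Ψ (embed μ ψ₀ Φ) =ᵐ[(volume : Measure ℝ).prod μ]
      fun x => 𝓕⁻ h x.1 • (Φ x.2 • ψ₀) := by
    filter_upwards [coeFn_tensor Ψ (embed μ ψ₀ Φ),
      (Measure.quasiMeasurePreserving_fst (μ := (volume : Measure ℝ)) (ν := μ)).ae_eq_comp hΨ,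
      (Measure.quasiMeasurePreserving_snd (μ := (volume : Measure ℝ)) (ν := μ)).ae_eq_comp
        (coeFn_embed ψ₀ Φ)] with x hx1 hx2 hx3
    simp only [Function.comp_apply] at hx2 hx3
    rw [hx1, hx2, hx3]
  refine (coeFn_evolve φ a ħ α β 1 _).trans ((evolveFun_congr φ a ħ α β 1 h1).trans
    (Filter.Eventually.of_forall fun x => ?_))
  simp [evolveFun, finalWave, flow]

/-- The amplitude of the probe that remains after pairing the final state with `u`. -/
noncomputable def probeAmplitude (h : ℝ → ℂ) (u : SysPointer H μ) (ξ : ℝ) : ℂ :=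
  ∑ k, inner ℂ (φ k) ψ₀ * componentAmplitude h ħ α β (a k) (φ k) u Φ
    (ξ - -(α * a k / (2 * Real.pi * ħ)))

theorem integrable_probeAmplitude (h1 : Integrable h) (u : SysPointer H μ) :
    Integrable (probeAmplitude φ a ħ α β ψ₀ Φ h u) :=
  integrable_finsetSum _ fun k _ =>
    ((integrable_componentAmplitude ħ α β (a k) (φ k) u Φ h1).comp_sub_right _).const_mul _

theorem memLp_probeAmplitude (h2 : MemLp h 2 volume) (u : SysPointer H μ) :
    MemLp (probeAmplitude φ a ħ α β ψ₀ Φ h u) 2 volume :=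
  memLp_finsetSum _ fun k _ =>
    ((memLp_componentAmplitude ħ α β (a k) (φ k) u Φ h2).comp_measurePreserving
      (measurePreserving_sub_right volume _)).const_mul _

theorem norm_fourierInv_le (h : ℝ → ℂ) (x : ℝ) : ‖𝓕⁻ h x‖ ≤ ∫ ξ, ‖h ξ‖ :=
  VectorFourier.norm_fourierIntegral_le_integral_norm _ _ _ _ _

variable {ħ} in
-- The phase at time one splits into `exp(-iαa_k q/ħ)`, a frequency shift of the probe, and
-- `exp(iαa_k βb/(2ħ))`, the source of `αa_k/2` in `ρ_k`.
theorem integral_inner_finalWave [SFinite μ] (hħ : ħ ≠ 0) (h1 : Integrable h) (u : SysPointer H μ) (q : ℝ) :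
    ∫ b, inner ℂ (u b) (finalWave φ a ħ α β ψ₀ Φ h (q, b)) ∂μ =
      𝓕⁻ (probeAmplitude φ a ħ α β ψ₀ Φ h u) q := by
  let f : ι → ℝ → ℂ := fun k b =>
    Complex.exp (Complex.I * (α * a k * β / (2 * ħ) : ℝ) * b) * (inner ℂ (u b) (φ k) * Φ b) *
      𝓕⁻ h (q - β * b)
  have hf : ∀ k, Integrable (f k) μ := by
    intro k
    have h3 : Integrable (fun b : ℝ => Complex.exp (Complex.I * (α * a k * β / (2 * ħ) : ℝ) * b) *
        (inner ℂ (u b) (φ k) * Φ b)) μ :=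
      (integrable_inner_mul (φ k) u Φ).bdd_mul (c := 1)
        (Continuous.aestronglyMeasurable (by fun_prop))
        (Filter.Eventually.of_forall fun b => (norm_exp_phase _ b).le)
    refine (h3.bdd_mul (c := ∫ ξ, ‖h ξ‖) (f := fun b => 𝓕⁻ h (q - β * b))
      ((continuous_fourierInv h1).comp (by fun_prop : Continuous fun b => q - β * b)
        |>.aestronglyMeasurable)
      (Filter.Eventually.of_forall fun b => norm_fourierInv_le h _)).congr
      (Filter.Eventually.of_forall fun b => mul_comm _ _)
  let c : ι → ℂ := fun k =>
    Complex.exp ((2 * Real.pi * -(α * a k / (2 * Real.pi * ħ)) * q : ℝ) * Complex.I)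
  have hpt : ∀ b, inner ℂ (u b) (finalWave φ a ħ α β ψ₀ Φ h (q, b)) =
      ∑ k, inner ℂ (φ k) ψ₀ * c k * f k b := by
    intro b
    rw [finalWave, inner_sum]
    refine Finset.sum_congr rfl fun k _ => ?_
    have he : Complex.exp (flowPhase ħ α β (a k) 1 (q, b) * Complex.I) =
        c k * Complex.exp (Complex.I * (α * a k * β / (2 * ħ) : ℝ) * b) := by
      have hħ' : (ħ : ℂ) ≠ 0 := by exact_mod_cast hħ
      have hpi : (Real.pi : ℂ) ≠ 0 := by exact_mod_cast Real.pi_ne_zero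
      rw [← Complex.exp_add, flowPhase]
      congr 1
      push_cast
      field_simp
      ring
    rw [inner_smul_right, he]
    simp only [f]
    ring
  simp only [hpt]
  rw [integral_finsetSum _ fun k _ => (hf k).const_mul _, Real.fourierInv_eq']
  simp only [probeAmplitude, Finset.smul_sum]
  have hint : ∀ k, Integrable fun ξ : ℝ =>
      Complex.exp (((2 * Real.pi * inner ℝ ξ q : ℝ) : ℂ) * Complex.I) •
        (inner ℂ (φ k) ψ₀ * componentAmplitude h ħ α β (a k) (φ k) u Φ
          (ξ - -(α * a k / (2 * Real.pi * ħ)))) := by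
    intro k
    refine (((integrable_componentAmplitude ħ α β (a k) (φ k) u Φ h1).comp_sub_right _).const_mul
      _).bdd_mul (c := 1) (Continuous.aestronglyMeasurable (by fun_prop))
      (Filter.Eventually.of_forall fun ξ => ?_)
    rw [Complex.norm_exp_ofReal_mul_I]
  rw [integral_finsetSum _ fun k _ => hint k]
  refine Finset.sum_congr rfl fun k _ => ?_
  have hm := fourierInv_modulate_translate (componentAmplitude h ħ α β (a k) (φ k) u Φ) 0
    (-(α * a k / (2 * Real.pi * ħ))) q
  rw [sub_zero, fourierInv_componentAmplitude α β (a k) (φ k) u Φ hħ h1, Real.fourierInv_eq'] at hm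
  rw [integral_const_mul, mul_assoc]
  change _ * (c k * ∫ b, f k b ∂μ) = _
  rw [← hm, ← integral_const_mul]
  refine integral_congr_ae (Filter.Eventually.of_forall fun ξ => ?_)
  simp [mul_left_comm]

variable {φ a ħ α} in
/-- Interference terms drop out of the overlap of two probe amplitudes. -/
theorem integral_probeAmplitude_mul_conj {κ : ℝ} (h2 : MemLp h 2 volume)
    (hs : ∀ ξ, κ < |2 * Real.pi * ξ| → h ξ = 0)
    (hgap : ∀ k l, k ≠ l → 2 * κ < 2 * Real.pi * |α * (a k - a l) / (2 * Real.pi * ħ)|)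
    (u v : SysPointer H μ) :
    ∫ ξ, probeAmplitude φ a ħ α β ψ₀ Φ h u ξ * conj (probeAmplitude φ a ħ α β ψ₀ Φ h v ξ) =
      ∑ k, (‖inner ℂ (φ k) ψ₀‖ ^ 2 : ℝ) *
        ∫ ξ, componentAmplitude h ħ α β (a k) (φ k) u Φ ξ *
          conj (componentAmplitude h ħ α β (a k) (φ k) v Φ ξ) := by
  let g : SysPointer H μ → ι → ℝ → ℂ := fun u k ξ =>
    componentAmplitude h ħ α β (a k) (φ k) u Φ (ξ - -(α * a k / (2 * Real.pi * ħ)))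
  have hg : ∀ u k, MemLp (g u k) 2 volume := fun u k =>
    (memLp_componentAmplitude ħ α β (a k) (φ k) u Φ h2).comp_measurePreserving
      (measurePreserving_sub_right volume _)
  have hpt : ∀ ξ, probeAmplitude φ a ħ α β ψ₀ Φ h u ξ *
      conj (probeAmplitude φ a ħ α β ψ₀ Φ h v ξ) =
      ∑ k, ((‖inner ℂ (φ k) ψ₀‖ ^ 2 : ℝ) : ℂ) * (g u k ξ * conj (g v k ξ)) := by
    intro ξ
    simp only [probeAmplitude, map_sum, Finset.sum_mul_sum]
    refine Finset.sum_congr rfl fun k _ => ?_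
    rw [Finset.sum_eq_single k]
    · rw [map_mul, mul_mul_mul_comm, Complex.mul_conj, Complex.normSq_eq_norm_sq]
    · intro l _ hlk
      -- Off the diagonal the product contains two translates of `h` further apart than the band
      -- width.
      have h0 := mul_eq_zero_of_band hs (s := -(α * a k / (2 * Real.pi * ħ)))
        (t := -(α * a l / (2 * Real.pi * ħ))) (by
          have := hgap l k hlk
          rwa [show -(α * a k / (2 * Real.pi * ħ)) - -(α * a l / (2 * Real.pi * ħ)) =
            α * (a l - a k) / (2 * Real.pi * ħ) by ring]) ξ
      simp only [componentAmplitude, map_mul]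
      linear_combination (inner ℂ (φ k) ψ₀ *
        overlap (φ k) u Φ ((α * a k / 2 -
          2 * Real.pi * ħ * (ξ - -(α * a k / (2 * Real.pi * ħ)))) * β / ħ) *
        conj (inner ℂ (φ l) ψ₀) *
        conj (overlap (φ l) v Φ ((α * a l / 2 -
          2 * Real.pi * ħ * (ξ - -(α * a l / (2 * Real.pi * ħ)))) * β / ħ))) * h0
    · simp
  simp only [hpt]
  rw [integral_finsetSum _ fun k _ => (integrable_mul_conj (hg u k) (hg v k)).const_mul _]
  refine Finset.sum_congr rfl fun k _ => ?_
  rw [integral_const_mul]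
  congr 1
  -- On the diagonal both factors carry the same shift, which translation invariance removes.
  exact integral_sub_right_eq_self (fun ξ => componentAmplitude h ħ α β (a k) (φ k) u Φ ξ *
    conj (componentAmplitude h ħ α β (a k) (φ k) v Φ ξ)) _

theorem sq_norm_momentumWave {ħ : ℝ} (hħ : 0 < ħ) (Ψ : Probe) (p : ℝ) :
    ‖momentumWave ħ Ψ p‖ ^ 2 =
      (2 * Real.pi * ħ)⁻¹ * ‖(𝓕 Ψ : Probe) (p / (2 * Real.pi * ħ))‖ ^ 2 := by
  rw [momentumWave, norm_mul, mul_pow, Complex.norm_real, Real.norm_eq_abs, sq_abs, div_pow,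
    Real.sq_sqrt (by positivity), one_pow, one_div]

/-- The rank one factor is norm continuous in `p` with norm `‖Φ‖²`, and `|⟨p|Ψ⟩|²` is integrable. So
the Bochner integral is not the default value zero and commutes with evaluation at vectors. -/
theorem integrable_pointerState {ħ : ℝ} (hħ : 0 < ħ) (Ψ : Probe) (ak : ℝ) :
    Integrable fun p : ℝ => ‖momentumWave ħ Ψ p‖ ^ 2 •
      InnerProductSpace.rankOne ℂ (phase ((α * ak / 2 - p) * β / ħ) Φ)
        (phase ((α * ak / 2 - p) * β / ħ) Φ) := by
  have hc : Continuous fun p : ℝ => phase ((α * ak / 2 - p) * β / ħ) Φ :=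
    (continuous_phase Φ).comp (by fun_prop)
  have hr : Continuous fun p : ℝ =>
      InnerProductSpace.rankOne ℂ (phase ((α * ak / 2 - p) * β / ħ) Φ)
        (phase ((α * ak / 2 - p) * β / ħ) Φ) :=
    ((ContinuousLinearMap.toSpanSingletonCLE (𝕜 := ℂ)).continuous.comp hc).clm_comp
      ((innerSL ℂ).continuous.comp hc)
  have hm : Integrable fun p : ℝ => ‖momentumWave ħ Ψ p‖ ^ 2 := by
    simp only [sq_norm_momentumWave hħ]
    exact (((memLp_two_iff_integrable_sq_norm (Lp.memLp (𝓕 Ψ : Probe)).1).1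
      (Lp.memLp (𝓕 Ψ : Probe))).comp_div (by positivity)).const_mul _
  refine (hm.mul_const (‖Φ‖ * ‖Φ‖)).mono' (hm.1.smul hr.aestronglyMeasurable)
    (Filter.Eventually.of_forall fun p => ?_)
  rw [norm_smul, InnerProductSpace.norm_rankOne, norm_phase, Real.norm_of_nonneg (by positivity)]

theorem inner_projTensor_pointerState {ħ : ℝ} (hħ : 0 < ħ) {Ψ : Probe}
    (hΨ : (𝓕 Ψ : Probe) =ᵐ[volume] h) (ak : ℝ) (w : H) (u v : SysPointer H μ) :
    inner ℂ u (projTensor w (pointerState ħ α β Ψ Φ ak) v) =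
      ∫ ξ, componentAmplitude h ħ α β ak w u Φ ξ *
        conj (componentAmplitude h ħ α β ak w v Φ ξ) := by
  have hint := integrable_pointerState α β Φ hħ Ψ ak
  have hne : 2 * Real.pi * ħ ≠ 0 := by positivity
  change inner ℂ u (embed μ w (pointerState ħ α β Ψ Φ ak (contract μ w v))) = _
  rw [inner_embed_right, pointerState, ContinuousLinearMap.integral_apply hint,
    ← integral_inner (hint.apply_continuousLinearMap _)]
  let K : ℝ → ℂ := fun ξ => ((‖(𝓕 Ψ : Probe) ξ‖ ^ 2 : ℝ) : ℂ) *
    (overlap w u Φ ((α * ak / 2 - 2 * Real.pi * ħ * ξ) * β / ħ) *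
      conj (overlap w v Φ ((α * ak / 2 - 2 * Real.pi * ħ * ξ) * β / ħ)))
  have h1 : ∀ p : ℝ, inner ℂ (contract μ w u) ((‖momentumWave ħ Ψ p‖ ^ 2 •
      InnerProductSpace.rankOne ℂ (phase ((α * ak / 2 - p) * β / ħ) Φ)
        (phase ((α * ak / 2 - p) * β / ħ) Φ)) (contract μ w v)) =
      (((2 * Real.pi * ħ)⁻¹ : ℝ) : ℂ) * K (p / (2 * Real.pi * ħ)) := by
    intro p
    have hp : 2 * Real.pi * ħ * (p / (2 * Real.pi * ħ)) = p := by field_simp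
    rw [smul_apply, InnerProductSpace.rankOne_apply, sq_norm_momentumWave hħ,
      inner_smul_right_eq_smul, inner_smul_right, Complex.real_smul]
    simp only [K, hp, overlap, inner_conj_symm]
    push_cast
    ring
  simp only [h1]
  -- The substitution `p = 2πħξ` cancels the normalization `(2πħ)⁻¹`.
  rw [integral_const_mul, Measure.integral_comp_div, abs_of_pos (by positivity),
    Complex.real_smul, ← mul_assoc, ← Complex.ofReal_mul, inv_mul_cancel₀ hne, Complex.ofReal_one,
    one_mul]
  refine integral_congr_ae ?_
  filter_upwards [hΨ] with ξ hξ
  simp only [K, componentAmplitude, hξ, map_mul]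
  rw [mul_mul_mul_comm, Complex.mul_conj, Complex.normSq_eq_norm_sq]

variable {φ a α} in
theorem isProbeTrace_evolve [SFinite μ] {ħ κ : ℝ} (hħ : 0 < ħ) {Ψ : Probe} (h1 : Integrable h)
    (h2 : MemLp h 2 volume) (hs : ∀ ξ, κ < |2 * Real.pi * ξ| → h ξ = 0)
    (hΨ : Ψ =ᵐ[volume] 𝓕⁻ h)
    (hgap : ∀ k l, k ≠ l → 2 * κ < 2 * Real.pi * |α * (a k - a l) / (2 * Real.pi * ħ)|) :
    IsProbeTrace (InnerProductSpace.rankOne ℂ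
        (evolve φ a ħ α β μ 1 (tensor Ψ (embed μ ψ₀ Φ)))
        (evolve φ a ħ α β μ 1 (tensor Ψ (embed μ ψ₀ Φ))))
      (∑ k, ‖inner ℂ (φ k) ψ₀‖ ^ 2 • projTensor (φ k) (pointerState ħ α β Ψ Φ (a k))) := by
  intro κ' e u v
  -- Identifies the amplitude of the band limit with the momentum wave function that occurs in
  -- `ρ_k`.
  have hF : (𝓕 Ψ : Probe) =ᵐ[volume] h := by
    have h3 : Ψ = 𝓕⁻ (h2.toLp h) := Lp.ext (hΨ.trans (coeFn_fourierInv_toLp h1 h2).symm)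
    rw [h3, FourierTransform.fourier_fourierInv_eq]
    exact h2.coeFn_toLp
  have ha1 := integrable_probeAmplitude φ a ħ α β ψ₀ Φ h1
  have ha2 := memLp_probeAmplitude φ a ħ α β ψ₀ Φ h2
  let g : SysPointer H μ → Probe := fun u => 𝓕⁻ ((ha2 u).toLp _)
  have hg : ∀ (e : Probe) (u : SysPointer H μ),
      inner ℂ (tensor e u) (evolve φ a ħ α β μ 1 (tensor Ψ (embed μ ψ₀ Φ))) =
        inner ℂ e (g u) := by
    intro e u
    refine inner_tensor_eq e (g u) u _ (evolve_tensor_ae_eq φ a ħ α β ψ₀ Φ hΨ) ?_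
    filter_upwards [coeFn_fourierInv_toLp (ha1 u) (ha2 u)] with q hq
    rw [integral_inner_finalWave φ a α β ψ₀ Φ hħ.ne' h1, hq]
  -- Each summand of the trace is `⟨g v, e_n⟩⟨e_n, g u⟩`, so the sum is `⟨g v, g u⟩` in every basis.
  have hsum := e.hasSum_inner_mul_inner (g v) (g u)
  have hval : inner ℂ (g v) (g u) = inner ℂ u ((∑ k, ‖inner ℂ (φ k) ψ₀‖ ^ 2 •
      projTensor (φ k) (pointerState ħ α β Ψ Φ (a k))) v) := by
    rw [inner_fourierInv, L2.inner_def, sum_apply, inner_sum]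
    have h4 : ∫ ξ, inner ℂ ((ha2 v).toLp _ ξ) ((ha2 u).toLp _ ξ) =
        ∫ ξ, probeAmplitude φ a ħ α β ψ₀ Φ h u ξ *
          conj (probeAmplitude φ a ħ α β ψ₀ Φ h v ξ) := by
      refine integral_congr_ae ?_
      filter_upwards [(ha2 v).coeFn_toLp, (ha2 u).coeFn_toLp] with ξ hv hu
      rw [hv, hu, RCLike.inner_apply]
    rw [h4, integral_probeAmplitude_mul_conj β ψ₀ Φ h2 hs hgap]
    refine Finset.sum_congr rfl fun k _ => ?_
    rw [smul_apply, inner_smul_right_eq_smul, Complex.real_smul,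
      inner_projTensor_pointerState α β Φ hħ hF]
  rw [hval] at hsum
  refine hsum.congr_fun ?_
  intro n
  rw [InnerProductSpace.rankOne_apply, inner_smul_right, hg, ← inner_conj_symm, hg,
    inner_conj_symm]

end ProbeTrace

end ProbeMeasurement

theorem mainTheorem2
    {H : Type*} [NormedAddCommGroup H] [InnerProductSpace ℂ H]
    {ι : Type*} [Fintype ι]
    (A : H →ₗ[ℂ] H) (φ : OrthonormalBasis ι ℂ H) (a : ι → ℝ)
    (hA : ∀ k, A (φ k) = (a k : ℂ) • φ k) (ha : Function.Injective a)
    (a₀ : ℝ) (ha₀ : IsLeast {d : ℝ | ∃ k l, a l < a k ∧ d = a k - a l} a₀)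
    (μ : Measure ℝ) [IsLocallyFiniteMeasure μ]
    (ħ κ₀ α lam : ℝ) (hħ : 0 < ħ) (hlam : 0 < lam)
    (ψ₀ : H) (Ψ : ProbeMeasurement.Probe) (Φ : ProbeMeasurement.Pointer μ)
    (hψ₀ : ‖ψ₀‖ = 1) (hΨ : ‖Ψ‖ = 1) (hΦ : ‖Φ‖ = 1)
    (hlim : ProbeMeasurement.IsMomentumLimited κ₀ Ψ)
    (hα : 2 * ħ * κ₀ / a₀ < α) :
    -- the complex extension of the probe wave function, and its products
    (∃ f : ℂ → ℂ, Differentiable ℂ f ∧ (Ψ =ᵐ[volume] fun x : ℝ => f x) ∧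
      ProbeMeasurement.IsExponentialType κ₀ f ∧
      ∀ b b' : ℝ,
        Differentiable ℂ (fun z : ℂ => f (z - (2 * lam * b / α : ℝ)) *
          conj (f (conj z - (2 * lam * b' / α : ℝ)))) ∧
        ProbeMeasurement.IsExponentialType (2 * κ₀)
          (fun z : ℂ => f (z - (2 * lam * b / α : ℝ)) *
            conj (f (conj z - (2 * lam * b' / α : ℝ))))) ∧
    -- the coherence kernels vanish
    (∀ k l, k ≠ l → ∀ b b' : ℝ,
      Integrable (ProbeMeasurement.coherenceIntegrand ħ α lam Ψ (a k) (a l) b b') ∧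
      ProbeMeasurement.coherenceKernel ħ α lam Ψ (a k) (a l) b b' = 0) ∧
    -- the evolution `exp(-i t H_M / ħ)` is well defined
    (∃! V : ℝ → (ProbeMeasurement.Total H μ ≃ₗᵢ[ℂ] ProbeMeasurement.Total H μ),
      ProbeMeasurement.IsEvolution ħ α (2 * lam / α) A V) ∧
    -- the probe-traced final state
    (∀ V : ℝ → (ProbeMeasurement.Total H μ ≃ₗᵢ[ℂ] ProbeMeasurement.Total H μ),
      ProbeMeasurement.IsEvolution ħ α (2 * lam / α) A V →
      ProbeMeasurement.IsProbeTrace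
        (InnerProductSpace.rankOne ℂ
          (V 1 (ProbeMeasurement.tensor Ψ (ProbeMeasurement.embed μ ψ₀ Φ)))
          (V 1 (ProbeMeasurement.tensor Ψ (ProbeMeasurement.embed μ ψ₀ Φ))))
        (∑ k, ‖inner ℂ (φ k) ψ₀‖ ^ 2 • ProbeMeasurement.projTensor (φ k)
          (ProbeMeasurement.pointerState ħ α (2 * lam / α) Ψ Φ (a k)))) := by 
  obtain ⟨h, h1, h2, hs, hΨh⟩ := hlim.exists_amplitude
  have hgap := fun k l (hkl : k ≠ l) => ProbeMeasurement.band_lt_gap ha ha₀ hħ hα hkl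
  have hV := ProbeMeasurement.isEvolution_evolve φ (μ := μ) α (2 * lam / α) hħ.ne' hA
  refine ⟨⟨ProbeMeasurement.entireExtension h,
    ProbeMeasurement.differentiable_entireExtension h1 hs, ?_,
    ProbeMeasurement.isExponentialType_entireExtension hlim.1 h1 hs, fun b b' =>
      ⟨ProbeMeasurement.differentiable_entireExtension_mul h1 hs _ _,
        ProbeMeasurement.isExponentialType_entireExtension_mul hlim.1 h1 hs _ _⟩⟩,
    fun k l hkl b b' => ⟨ProbeMeasurement.integrable_coherenceIntegrand h1 h2 hΨh ..,
      ProbeMeasurement.coherenceKernel_eq_zero h1 h2 hs hΨh (hgap k l hkl) lam b b'⟩,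
    ⟨_, hV, fun W hW => hW.eq_evolve φ α _ hħ.ne' hA⟩, fun V hV' => ?_⟩
  · refine hΨh.trans (Filter.Eventually.of_forall fun x => ?_)
    exact (ProbeMeasurement.entireExtension_ofReal h x).symm
  · rw [hV'.eq_evolve φ α _ hħ.ne' hA]
    exact ProbeMeasurement.isProbeTrace_evolve _ ψ₀ Φ hħ h1 h2 hs hΨh hgap
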